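/- Theorem (continuity iff computability). Let $\Sigma,\Gamma$ be finite alphabets, let $\mathcal D$ be a countably infinite set of data with a distinguished element $d_0$, and suppose that data are represented by finite words over a finite alphabet $A$ through an injective map $\mathrm{enc}:\mathcal D\to A^*$. A non-deterministic register transducer (NRT) $T=(Q,R,i_0,F,\Delta)$ consists of a finite set $Q$ of states, a finite set $R$ of registers, an initial state $i_0\in Q$, a set $F\subseteq Q$ of accepting states and a finite set $\Delta\subseteq Q\times\Sigma\times\mathrm{Tst}_R\times 2^R\times(\Gamma\times R)^*\times Q$ of transitions, where $\mathrm{Tst}_R$ is the set of Boolean combinations of tests $r^=$ and $r^{\neq}$ that compare the current datum with the content of a register $r\in R$. A transition $(q,\sigma,\phi,\mathrm{asgn},o,q')$ leads from the configuration $(q,\tau)$, $\tau:R\to\mathcal D$, to $(q',\tau')$ while reading $(\sigma,d)$, provided that $d$ satisfies $\phi$ in $\tau$; here $\tau'(r)=d$ for $r\in\mathrm{asgn}$ and $\tau'(r)=\tau(r)$ otherwise, and the output is obtained from $o$ by replacing each $(\gamma,r)$ by $(\gamma,\tau'(r))$. A run is accepting if it starts in $i_0$ with all registers containing $d_0$ and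 visits some state of $F$ infinitely often. The relation of $T$ is the set of pairs $(u,v)\in(\Sigma\times\mathcal D)^\omega\times(\Gamma\times\mathcal D)^\omega$ such that some accepting run of $T$ has input $u$ and output $v$. Let $f:(\Sigma\times\mathcal D)^\omega\to(\Gamma\times\mathcal D)^\omega$ be a partial function whose graph is the relation of some NRT. Then $f$ is continuous if and only if $f$ is computable. Here: - On finite or infinite words let $d(u,v)=0$ if $u=v$ and $d(u,v)=2^{-|u\wedge v|}$ otherwise, where $u\wedge v$ is the longest common prefix. The function $f$ is continuous if, for every $x\in\mathrm{dom}(f)$ and every sequence $(x_n)$ in $\mathrm{dom}(f)$ converging to $x$ for $d$, the sequence $(f(x_n))$ converges to $f(x)$. - The function $f$ is computable if there is a deterministic Turing machine $M$ with a read-only one-way input tape, a two-way working tape and a write-only one-way output tape, with finitely many states and tape symbols, such that for every $x\in\mathrm{dom}(f)$, when the representation of $x$ is on the input tape, the sequence $(M(x,k))_{k\ge 0}$ converges for $d$ to the representation of $f(x)$. Here $M(x,k)$ is the word that $M$ writes on its output tape while it reads only the first $k$ cells of its input tape, and a data word is represented on a tape by writing, for each of its letters $(\sigma,d)$ in turn,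 the label $\sigma$, the word $\mathrm{enc}(d)$ and an end marker. -/

import Mathlib

namespace DataWord

/-! ### Finite and infinite words -/

/-- Finite or infinite words over `α`: the set `α^∞ = α^* ∪ α^ω`. -/
abbrev Word (α : Type*) := Stream'.Seq α

/-- An infinite word, given as a function on positions (counted from `0`), seen in `α^∞`. -/
def Word.inf {α : Type*} (x : ℕ → α) : Word α :=
  ⟨fun i => some (x i), by intro n h; cases h⟩

/-- The concatenation `v 0 · v 1 · v 2 ⋯` of infinitely many finite words. It is finite if all but
finitely many of them are empty. Its letter at position `i` is the letter at position `i` of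
`v 0 ⋯ v (n-1)` as soon as that word is longer than `i`. -/
noncomputable def Word.concat {α : Type*} (v : ℕ → List α) : Word α := by
  classical
  exact
    ⟨fun i => if h : ∃ n, i < ((List.range n).flatMap v).length
        then ((List.range (Nat.find h)).flatMap v)[i]? else none, by
      intro i hi
      have key : ∀ j, (if h : ∃ n, j < ((List.range n).flatMap v).length
          then ((List.range (Nat.find h)).flatMap v)[j]? else none) = none ↔
          ¬ ∃ n, j < ((List.range n).flatMap v).length := by
        intro j
        constructor
        · intro hj h
          rw [dif_pos h] at hj
          exact absurd (Nat.find_spec h) (not_lt.mpr (List.getElem?_eq_none_iff.mp hj))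
        · intro h
          rw [dif_neg h]
      refine (key (i + 1)).mpr fun ⟨n, hn⟩ => (key i).mp hi ⟨n, by omega⟩⟩

/-- The Cantor distance on `α^∞`: `0` if `u = v`, and otherwise `2 ^ (-ℓ)` where `ℓ` is the length
of the longest common prefix of `u` and `v`. For `u ≠ v` this length is the first position at which
`u` and `v` differ, where the value beyond the end of a finite word is `none`. -/
noncomputable def Word.cantorDist {α : Type*} (u v : Word α) : ℝ := by
  classical
  exact if u = v then 0 else (2 : ℝ)⁻¹ ^ sInf {i : ℕ | u.get? i ≠ v.get? i}

/-- Convergence of a sequence of words for the Cantor distance. -/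
def Word.ConvergesTo {α : Type*} (u : ℕ → Word α) (v : Word α) : Prop :=
  ∀ ε : ℝ, 0 < ε → ∃ N : ℕ, ∀ n ≥ N, Word.cantorDist (u n) v ≤ ε

/-- Continuity, for the Cantor distance, of a partial function on infinite words: for each `x` in
the domain and each sequence of elements of the domain converging to `x`, the images converge to
the image of `x`. -/
def IsContinuous {α β : Type*} (f : (ℕ → α) →. (ℕ → β)) : Prop :=
  ∀ (x : ℕ → α) (hx : x ∈ f.Dom) (y : ℕ → ℕ → α) (hy : ∀ n, y n ∈ f.Dom),
    Word.ConvergesTo (fun n => Word.inf (y n)) (Word.inf x) →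
      Word.ConvergesTo (fun n => Word.inf (f.fn (y n) (hy n))) (Word.inf (f.fn x hx))

/-! ### Register transducers -/

/-- Symbolic tests over a set `R` of registers. -/
inductive Test (R : Type*) where
  | top : Test R
  | bot : Test R
  | eq (r : R) : Test R
  | ne (r : R) : Test R
  | conj (φ ψ : Test R) : Test R
  | disj (φ ψ : Test R) : Test R
  | neg (φ : Test R) : Test R

/-- `φ.Sat τ d`: the datum `d` satisfies the test `φ` in the valuation `τ`. -/
def Test.Sat {R D : Type*} (τ : R → D) (d : D) : Test R → Prop
  | .top => True
  | .bot => False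
  | .eq r => τ r = d
  | .ne r => τ r ≠ d
  | .conj φ ψ => φ.Sat τ d ∧ ψ.Sat τ d
  | .disj φ ψ => φ.Sat τ d ∨ ψ.Sat τ d
  | .neg φ => ¬ φ.Sat τ d

/-- Transitions: elements of `Q × S × Tst_R × 2^R × (G × R)^* × Q`. -/
structure Transition (S G Q R : Type*) where
  src : Q
  label : S
  test : Test R
  asgn : Set R
  out : List (G × R)
  dst : Q

/-- Non-deterministic register transducers with input labels `S`, output labels `G`, states `Q` and
registers `R` (the four of them are assumed to be finite when transducers are used). -/
structure NRT (S G Q R : Type*) where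
  init : Q
  accepting : Set Q
  trans : Set (Transition S G Q R)
  finite_trans : trans.Finite

/-- `T.Step c l w c'`: the transition system of `T` has a step from the configuration `c` to the
configuration `c'` that reads the labelled datum `l` and outputs the finite data word `w`. The
output refers to the contents of the registers after their update. -/
def NRT.Step {S G Q R D : Type*} (T : NRT S G Q R) (c : Q × (R → D)) (l : S × D)
    (w : List (G × D)) (c' : Q × (R → D)) : Prop :=
  ∃ t ∈ T.trans, t.src = c.1 ∧ t.dst = c'.1 ∧ t.label = l.1 ∧ t.test.Sat c.2 l.2 ∧
    (∀ r, (r ∈ t.asgn → c'.2 r = l.2) ∧ (r ∉ t.asgn → c'.2 r = c.2 r)) ∧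
    w = t.out.map (fun p => (p.1, c'.2 p.2))

/-- The relation represented by `T`, all of whose registers initially contain `d₀`: the pairs
`(u, v)` of infinite data words such that some accepting run (initial, and visiting some accepting
state infinitely often) has input `u` and output `v`. -/
def NRT.Rel {S G Q R D : Type*} (T : NRT S G Q R) (d₀ : D) (u : ℕ → S × D) (v : ℕ → G × D) :
    Prop :=
  ∃ (ρ : ℕ → Q × (R → D)) (o : ℕ → List (G × D)),
    ρ 0 = (T.init, fun _ => d₀) ∧
    (∀ n, T.Step (ρ n) (u n) (o n) (ρ (n + 1))) ∧
    (∃ q ∈ T.accepting, {n | (ρ n).1 = q}.Infinite) ∧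
    Word.concat o = Word.inf v

/-! ### Turing machines with infinite input -/

/-- What a machine does in one step: go to a state, write a symbol on the working tape, move (or
not) the working head, move (or not) the input head one cell to the right, and write (or not) one
symbol on the output tape. -/
structure Action (B Q W : Type*) where
  next : Q
  write : W
  move : Option Turing.Dir
  advance : Bool
  emit : Option B

/-- Deterministic three-tape Turing machines: a read-only one-way input tape over `A`, a two-way
working tape over `W` (with blank `default`), and a write-only one-way output tape over `B`.
An action is chosen from the state, the scanned input cell (`none` is the blank, which never
occurs on an infinite input) and the scanned working cell. A machine that halts is one that idles
in some state. The types `Q`, `W` are assumed to be finite when machines are used. -/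
structure Machine (A B Q W : Type*) where
  init : Q
  act : Q → Option A → W → Action B Q W

/-- Configurations: state, position of the input head, working tape. -/
structure Machine.Cfg (Q W : Type*) [Inhabited W] where
  state : Q
  head : ℕ
  work : Turing.Tape W

/-- The action that `M` takes in the configuration `c` on the input word `x`. -/
def Machine.action {A B Q W : Type*} [Inhabited W] (M : Machine A B Q W) (x : Word A)
    (c : Machine.Cfg Q W) : Action B Q W :=
  M.act c.state (x.get? c.head) c.work.head

/-- One step of `M` on the input word `x` (the output is treated separately). -/
def Machine.step {A B Q W : Type*} [Inhabited W] (M : Machine A B Q W) (x : Word A)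
    (c : Machine.Cfg Q W) : Machine.Cfg Q W where
  state := (M.action x c).next
  head := if (M.action x c).advance then c.head + 1 else c.head
  work :=
    match (M.action x c).move with
    | none => c.work.write (M.action x c).write
    | some dir => (c.work.write (M.action x c).write).move dir

/-- The configuration of `M` after `t` steps on the input word `x`, starting in the initial state
with the input head on the first cell and a blank working tape. -/
def Machine.run {A B Q W : Type*} [Inhabited W] (M : Machine A B Q W) (x : Word A) :
    ℕ → Machine.Cfg Q W
  | 0 => ⟨M.init, 0, Turing.Tape.mk₁ []⟩
  | t + 1 => M.step x (M.run x t)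

/-- `M(x, k)`: what `M` writes on its output tape while reading the first `k` cells of its input
tape only, that is, in the steps performed before its input head reaches the cell number `k`
(counted from `0`). This word is infinite if `M` writes infinitely often without reading more. -/
noncomputable def Machine.output {A B Q W : Type*} [Inhabited W] (M : Machine A B Q W)
    (x : Word A) (k : ℕ) : Word B :=
  Word.concat fun t =>
    if (M.run x t).head < k then (M.action x (M.run x t)).emit.toList else []

/-! ### Computability of functions of data words -/

/-- Tape symbols: labels, the symbols in which data are represented, and an end marker. -/
inductive Cell (S A : Type*) where
  | label (s : S) : Cell S A
  | digit (a : A) : Cell S A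
  | endMark : Cell S A

/-- The representation of a labelled datum on a tape: its label, then the word that represents its
datum, then an end marker. -/
def letterCode {S D A : Type*} (enc : D → List A) (l : S × D) : List (Cell S A) :=
  Cell.label l.1 :: ((enc l.2).map Cell.digit ++ [Cell.endMark])

/-- The representation of an infinite data word on a tape. -/
noncomputable def wordCode {S D A : Type*} (enc : D → List A) (x : ℕ → S × D) :
    Word (Cell S A) :=
  Word.concat fun n => letterCode enc (x n)

/-- Computability of a partial function of data words, where data are represented on tapes by the
finite words given by `enc`: for some deterministic machine `M`, for each `x` in the domain, the
sequence `M(x, 0), M(x, 1), …` converges to `f x`. -/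
def IsComputable {S G D A : Type*} (enc : D → List A)
    (f : (ℕ → S × D) →. (ℕ → G × D)) : Prop :=
  ∃ (Q W : Type) (_ : Finite Q) (_ : Finite W) (_ : Inhabited W)
    (M : Machine (Cell S A) (Cell G A) Q W),
    ∀ (x : ℕ → S × D) (hx : x ∈ f.Dom),
      Word.ConvergesTo (fun k => M.output (wordCode enc x) k) (wordCode enc (f.fn x hx))

end DataWord

namespace DataWord

/-! ### Prefixes and convergence of words -/

/-! A computable function is continuous because what a machine writes while reading `N` cells
depends on these cells only (`Machine.output_congr`) and is never revised
(`Machine.get?_of_output_convergesTo`). Cutting tape contents back into letters (`parse`) turns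
agreement of codes into agreement of data words.

For the converse, continuity says that each prefix `v` of `f x` is forced by some prefix `u` of `x`:
every accepting run whose input extends `u` has an output extending `v`. It is enough to search for
certificates of this fact. A certificate is a finite set of configurations over `ℕ`, closed under
transitions with data below a bound, in which no output mismatch has an accepting continuation once
`u` has been read. For soundness (`NRT.Certifies.isPre`), an arbitrary run is followed and its data
are renamed: apart from the data of `u`, `v` and the initial datum, only the equalities among the
current datum and the registers matter, so a permutation of `ℕ` brings each configuration into the
finite set. For completeness (`NRT.exists_certifies`), the certificate consists of all
configurations in a finite box whose continuations meet their expectation.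

Certificates can be checked primitive recursively (`NRT.primrecPred_certifies`). The delicate
ingredient is `NRT.Live`, the existence of an accepting continuation. It depends only on the state
and on which registers hold equal data, hence it is a finite table, and for a fixed transducer the
table may be built in without being computed. A datum enters as the number coding its representing
word, and `NRT.isPre_of_forall_isPre` transfers forcing from `D` to `ℕ`.

This gives a primitive recursive function that sends every tape prefix to a correct, possibly empty,
prefix of the code of `f x`, with unbounded lengths along `x`. `exists_machine` converts such a
function into a machine, by running compiled `ToPartrec.Code` on the working tape between successive
reads and writes. -/

/-- The finite word `l` is a prefix of the infinite word `y`. -/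
def IsPre {α : Type*} (l : List α) (y : ℕ → α) : Prop :=
  ∀ i a, l[i]? = some a → y i = a

/-- The prefix of length `n` of an infinite word. -/
def takePre {α : Type*} (n : ℕ) (x : ℕ → α) : List α := (List.range n).map x

section Prefix

variable {α β : Type*}

@[simp] theorem takePre_length (n : ℕ) (x : ℕ → α) : (takePre n x).length = n := by
  simp [takePre]

theorem takePre_getElem? (n : ℕ) (x : ℕ → α) (i : ℕ) :
    (takePre n x)[i]? = if i < n then some (x i) else none := by
  unfold takePre
  split_ifs with h
  · simp [h]
  · simp [not_lt.mp h]

theorem takePre_succ (n : ℕ) (x : ℕ → α) : takePre (n + 1) x = takePre n x ++ [x n] := by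
  simp [takePre, List.range_succ]

theorem takePre_map (f : α → β) (n : ℕ) (x : ℕ → α) :
    (takePre n x).map f = takePre n (f ∘ x) := by
  simp [takePre]

theorem isPre_takePre (n : ℕ) (x : ℕ → α) : IsPre (takePre n x) x := by
  intro i a h
  rw [takePre_getElem?] at h
  split_ifs at h
  exact Option.some.inj h

theorem isPre_iff_eq_takePre {l : List α} {x : ℕ → α} : IsPre l x ↔ l = takePre l.length x := by
  constructor
  · intro h
    apply List.ext_getElem?
    intro i
    rw [takePre_getElem?]
    split_ifs with hi
    · rw [h i l[i] (List.getElem?_eq_getElem hi), List.getElem?_eq_getElem hi]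
    · exact List.getElem?_eq_none (not_lt.mp hi)
  · intro h
    rw [h]
    exact isPre_takePre _ _

theorem isPre_takePre_iff {n : ℕ} {x y : ℕ → α} :
    IsPre (takePre n x) y ↔ ∀ i < n, y i = x i := by
  constructor
  · intro h i hi
    exact h i _ (by rw [takePre_getElem?, if_pos hi])
  · intro h i a hi
    rw [takePre_getElem?] at hi
    split_ifs at hi with hn
    rw [h i hn]
    exact Option.some.inj hi

@[simp] theorem isPre_nil (x : ℕ → α) : IsPre [] x := by
  intro i a h
  simp at h

theorem IsPre.of_prefix {l l' : List α} {x : ℕ → α} (h : IsPre l' x) (hl : l <+: l') :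
    IsPre l x := by
  obtain ⟨t, rfl⟩ := hl
  intro i a hi
  refine h i a ?_
  rw [List.getElem?_append_left (List.getElem?_eq_some_iff.mp hi).1, hi]

theorem isPre_append {l l' : List α} {x : ℕ → α} :
    IsPre (l ++ l') x ↔ IsPre l x ∧ IsPre l' (fun i => x (l.length + i)) := by
  constructor
  · intro h
    refine ⟨h.of_prefix (List.prefix_append _ _), fun i a hi => h _ a ?_⟩
    rw [List.getElem?_append_right (by omega)]
    simpa using hi
  · rintro ⟨h, h'⟩ i a hi
    by_cases hl : i < l.length
    · rw [List.getElem?_append_left hl] at hi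
      exact h i a hi
    · rw [List.getElem?_append_right (not_lt.mp hl)] at hi
      have : x (l.length + (i - l.length)) = a := h' _ a hi
      rwa [Nat.add_sub_cancel' (not_lt.mp hl)] at this

theorem isPre_cons {a : α} {l : List α} {x : ℕ → α} :
    IsPre (a :: l) x ↔ x 0 = a ∧ IsPre l (fun i => x (i + 1)) := by
  constructor
  · intro h
    exact ⟨h 0 a rfl, fun i b hi => h (i + 1) b (by simpa using hi)⟩
  · rintro ⟨h, h'⟩ i b hi
    cases i with
    | zero => simpa [h] using hi
    | succ i => exact h' i b (by simpa using hi)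

theorem IsPre.map {l : List α} {x : ℕ → α} (f : α → β) (h : IsPre l x) :
    IsPre (l.map f) (f ∘ x) := by
  intro i b hi
  rw [List.getElem?_map, Option.map_eq_some_iff] at hi
  obtain ⟨a, ha, rfl⟩ := hi
  simp [h i a ha]

theorem isPre_map_iff {l : List α} {x : ℕ → α} {f : α → β} (hf : Function.Injective f) :
    IsPre (l.map f) (f ∘ x) ↔ IsPre l x := by
  refine ⟨fun h i a hi => hf ?_, fun h => h.map f⟩
  exact h i (f a) (by rw [List.getElem?_map, hi]; rfl)

theorem IsPre.prefix_of_length_le {l l' : List α} {x : ℕ → α} (h : IsPre l x) (h' : IsPre l' x)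
    (hl : l.length ≤ l'.length) : l <+: l' := by
  rw [isPre_iff_eq_takePre.mp h, isPre_iff_eq_takePre.mp h', takePre, takePre]
  refine List.IsPrefix.map x ?_
  obtain ⟨k, hk⟩ := Nat.exists_eq_add_of_le hl
  rw [hk, List.range_add]
  exact List.prefix_append _ _

theorem prefix_flatMap_range {v : ℕ → List α} {m n : ℕ} (h : m ≤ n) :
    (List.range m).flatMap v <+: (List.range n).flatMap v := by
  obtain ⟨k, rfl⟩ := Nat.exists_eq_add_of_le h
  rw [List.range_add, List.flatMap_append]
  exact List.prefix_append _ _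

theorem getElem?_of_prefix {l l' : List α} (h : l <+: l') {i : ℕ} {a : α} (hi : l[i]? = some a) :
    l'[i]? = some a := by
  obtain ⟨t, rfl⟩ := h
  rw [List.getElem?_append_left (List.getElem?_eq_some_iff.mp hi).1, hi]

namespace Word

theorem inf_get? (x : ℕ → α) (i : ℕ) : (inf x).get? i = some (x i) := rfl

theorem concat_get?_eq_some_iff {v : ℕ → List α} {i : ℕ} {a : α} :
    (concat v).get? i = some a ↔ ∃ n, ((List.range n).flatMap v)[i]? = some a := by
  classical
  have key : (concat v).get? i = if h : ∃ n, i < ((List.range n).flatMap v).length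
        then ((List.range (Nat.find h)).flatMap v)[i]? else none := by
    unfold concat Stream'.Seq.get?
    simp only
  rw [key]
  constructor
  · intro h
    split_ifs at h with hn
    exact ⟨_, h⟩
  · rintro ⟨n, hn⟩
    have h : ∃ n, i < ((List.range n).flatMap v).length :=
      ⟨n, (List.getElem?_eq_some_iff.mp hn).1⟩
    rw [dif_pos h]
    obtain ⟨b, hb⟩ : ∃ b, ((List.range (Nat.find h)).flatMap v)[i]? = some b :=
      ⟨_, List.getElem?_eq_getElem (Nat.find_spec h)⟩
    rw [hb]
    have := getElem?_of_prefix
      (prefix_flatMap_range (Nat.find_min' h (List.getElem?_eq_some_iff.mp hn).1)) hb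
    rw [← this, hn]

theorem concat_eq_inf_iff {v : ℕ → List α} {y : ℕ → α} :
    concat v = inf y ↔ (∀ n, IsPre ((List.range n).flatMap v) y) ∧
      ∀ k, ∃ n, k < ((List.range n).flatMap v).length := by
  constructor
  · intro h
    refine ⟨fun n i a hi => ?_, fun k => ?_⟩
    · have := concat_get?_eq_some_iff.mpr ⟨n, hi⟩
      rw [h, inf_get?] at this
      exact Option.some.inj this
    · have : (concat v).get? k = some (y k) := by rw [h, inf_get?]
      obtain ⟨n, hn⟩ := concat_get?_eq_some_iff.mp this
      exact ⟨n, (List.getElem?_eq_some_iff.mp hn).1⟩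
  · rintro ⟨h₁, h₂⟩
    apply Stream'.Seq.ext
    intro i
    rw [inf_get?, concat_get?_eq_some_iff]
    obtain ⟨n, hn⟩ := h₂ i
    exact ⟨n, by rw [List.getElem?_eq_getElem hn, h₁ n i _ (List.getElem?_eq_getElem hn)]⟩

theorem cantorDist_le_iff {u v : Word α} {n : ℕ} :
    cantorDist u v ≤ (2 : ℝ)⁻¹ ^ n ↔ ∀ i < n, u.get? i = v.get? i := by
  classical
  unfold cantorDist
  split_ifs with h
  · subst h
    simp
  · have hne : {i : ℕ | u.get? i ≠ v.get? i}.Nonempty := by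
      by_contra hc
      apply h
      apply Stream'.Seq.ext
      intro i
      by_contra hi
      exact hc ⟨i, hi⟩
    rw [pow_le_pow_iff_right_of_lt_one₀ (by norm_num) (by norm_num)]
    constructor
    · intro hle i hi
      by_contra hc
      exact absurd (Nat.sInf_le (s := {i : ℕ | u.get? i ≠ v.get? i}) hc) (by omega)
    · intro hi
      by_contra hc
      exact Nat.sInf_mem hne (hi _ (not_le.mp hc))

theorem convergesTo_iff {u : ℕ → Word α} {w : Word α} :
    ConvergesTo u w ↔ ∀ k, ∃ N, ∀ n ≥ N, ∀ i < k, (u n).get? i = w.get? i := by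
  constructor
  · intro h k
    obtain ⟨N, hN⟩ := h ((2 : ℝ)⁻¹ ^ k) (by positivity)
    exact ⟨N, fun n hn => cantorDist_le_iff.mp (hN n hn)⟩
  · intro h ε hε
    obtain ⟨k, hk⟩ := exists_pow_lt_of_lt_one hε (show (2 : ℝ)⁻¹ < 1 by norm_num)
    obtain ⟨N, hN⟩ := h k
    exact ⟨N, fun n hn => (cantorDist_le_iff.mpr (hN n hn)).trans hk.le⟩

end Word

theorem flatMap_range_succ' (v : ℕ → List α) (n : ℕ) :
    (List.range (n + 1)).flatMap v = v 0 ++ (List.range n).flatMap (fun i => v (i + 1)) := by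
  rw [List.range_succ_eq_map]
  simp [List.flatMap_map]

theorem flatMap_range_succ (v : ℕ → List α) (n : ℕ) :
    (List.range (n + 1)).flatMap v = (List.range n).flatMap v ++ v n := by
  simp [List.range_succ]

end Prefix

/-- Sequential continuity amounts to the fact that each finite prefix of the image of `x` is
determined, within the domain, by some finite prefix of `x`. -/
theorem isContinuous_iff {α β : Type*} (f : (ℕ → α) →. (ℕ → β)) :
    IsContinuous f ↔ ∀ (x : ℕ → α) (hx : x ∈ f.Dom) (k : ℕ), ∃ n, ∀ (y : ℕ → α) (hy : y ∈ f.Dom),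
      IsPre (takePre n x) y → IsPre (takePre k (f.fn x hx)) (f.fn y hy) := by
  constructor
  · intro h x hx k
    by_contra! hc
    choose y hy hxy hf using hc
    have := h x hx y hy (Word.convergesTo_iff.mpr fun m => ⟨m, fun n hn i hi => by
      rw [Word.inf_get?, Word.inf_get?, isPre_takePre_iff.mp (hxy n) i (by omega)]⟩)
    obtain ⟨N, hN⟩ := Word.convergesTo_iff.mp this k
    exact hf N (isPre_takePre_iff.mpr fun i hi => Option.some.inj (hN N le_rfl i hi))
  · intro h x hx y hy hxy
    rw [Word.convergesTo_iff] at hxy ⊢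
    intro k
    obtain ⟨n, hn⟩ := h x hx k
    obtain ⟨N, hN⟩ := hxy n
    refine ⟨N, fun m hm i hi => ?_⟩
    rw [Word.inf_get?, Word.inf_get?, isPre_takePre_iff.mp (hn (y m) (hy m) (isPre_takePre_iff.mpr
      fun i hi => Option.some.inj (hN m hm i hi))) i hi]

/-! ### What a machine writes -/

namespace Machine

variable {A B Q W : Type*} [Inhabited W] (M : Machine A B Q W) (x : Word A)

/-- The word that `M` writes in its first `t` steps on the input word `x`. -/
def written (t : ℕ) : List B :=
  (List.range t).flatMap fun s => (M.action x (M.run x s)).emit.toList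

theorem written_succ (t : ℕ) :
    M.written x (t + 1) = M.written x t ++ (M.action x (M.run x t)).emit.toList :=
  flatMap_range_succ _ _

theorem written_prefix {s t : ℕ} (h : s ≤ t) : M.written x s <+: M.written x t :=
  prefix_flatMap_range h

theorem head_succ (t : ℕ) : (M.run x (t + 1)).head =
    if (M.action x (M.run x t)).advance then (M.run x t).head + 1 else (M.run x t).head := rfl

theorem head_mono : Monotone fun t => (M.run x t).head := by
  refine monotone_nat_of_le_succ fun t => ?_
  rw [head_succ]
  split_ifs <;> omega

theorem head_le (t : ℕ) : (M.run x t).head ≤ t := by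
  induction t with
  | zero => exact le_rfl
  | succ t ih => rw [head_succ]; split_ifs <;> omega

theorem flatMap_output_eq {k t : ℕ} (h : ∀ s < t, (M.run x s).head < k) :
    ((List.range t).flatMap fun s =>
      if (M.run x s).head < k then (M.action x (M.run x s)).emit.toList else []) =
      M.written x t := by
  unfold written
  rw [List.flatMap_def, List.flatMap_def]
  congr 1
  refine List.map_congr_left fun s hs => ?_
  rw [if_pos (h s (List.mem_range.mp hs))]

/-- The input head never moves back, so the steps with head below `k` form an initial segment of the
run, and cutting the output off at `k` amounts to stopping the machine at some time. -/
theorem exists_flatMap_output_eq (k t : ℕ) : ∃ s ≤ t, (∀ r < s, (M.run x r).head < k) ∧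
    ((List.range t).flatMap fun s =>
      if (M.run x s).head < k then (M.action x (M.run x s)).emit.toList else []) =
      M.written x s := by
  induction t with
  | zero => exact ⟨0, le_rfl, by simp, rfl⟩
  | succ t ih =>
    by_cases h : (M.run x t).head < k
    · have h' : ∀ r < t + 1, (M.run x r).head < k := fun r hr =>
        (M.head_mono x (Nat.lt_succ_iff.mp hr)).trans_lt h
      exact ⟨t + 1, le_rfl, h', M.flatMap_output_eq x h'⟩
    · obtain ⟨s, hs, h₁, h₂⟩ := ih
      refine ⟨s, by omega, h₁, ?_⟩
      rw [flatMap_range_succ, if_neg h, List.append_nil, h₂]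

theorem output_mono {k k' : ℕ} (hk : k ≤ k') {i : ℕ} {b : B}
    (h : (M.output x k).get? i = some b) : (M.output x k').get? i = some b := by
  obtain ⟨t, ht⟩ := Word.concat_get?_eq_some_iff.mp h
  obtain ⟨s, -, h₁, h₂⟩ := M.exists_flatMap_output_eq x k t
  refine Word.concat_get?_eq_some_iff.mpr ⟨s, ?_⟩
  rw [flatMap_output_eq _ _ fun r hr => (h₁ r hr).trans_le hk, ← h₂, ht]

/-- By `output_mono` a symbol once written persists in all later outputs, hence in their limit. -/
theorem get?_of_output_convergesTo {w : Word B}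
    (h : Word.ConvergesTo (fun k => M.output x k) w) {k i : ℕ} {b : B}
    (hb : (M.output x k).get? i = some b) : w.get? i = some b := by
  obtain ⟨N, hN⟩ := Word.convergesTo_iff.mp h (i + 1)
  rw [← hN (max N k) (le_max_left _ _) i (Nat.lt_succ_self i)]
  exact M.output_mono x (le_max_right _ _) hb

-- The two runs coincide until the head reaches cell `k`; from then on both heads stay at or beyond
-- `k`, and neither run contributes any output.
variable {x} in
theorem output_congr {x' : Word A} {k : ℕ} (h : ∀ i < k, x.get? i = x'.get? i) :
    M.output x k = M.output x' k := by
  have key : ∀ t, M.run x t = M.run x' t ∨ k ≤ (M.run x t).head ∧ k ≤ (M.run x' t).head := by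
    intro t
    induction t with
    | zero => exact Or.inl rfl
    | succ t ih =>
      rcases ih with ih | ⟨h₁, h₂⟩
      · by_cases hk : (M.run x t).head < k
        · left
          have : M.action x (M.run x t) = M.action x' (M.run x' t) := by
            rw [← ih, action, action, h _ hk]
          rw [run, run, step, step, this, ih]
        · right
          have h₁ := M.head_mono x (Nat.le_succ t)
          have h₂ := M.head_mono x' (Nat.le_succ t)
          simp only [← ih] at h₁ h₂
          exact ⟨(not_lt.mp hk).trans h₁, (not_lt.mp hk).trans h₂⟩
      · right
        exact ⟨h₁.trans (M.head_mono x (Nat.le_succ t)), h₂.trans (M.head_mono x' (Nat.le_succ t))⟩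
  unfold output
  congr 1
  funext t
  rcases key t with ht | ⟨h₁, h₂⟩
  · rw [← ht]
    split_ifs with hk
    · rw [action, action, h _ hk]
    · rfl
  · rw [if_neg (not_lt.mpr h₁), if_neg (not_lt.mpr h₂)]

/-- If everything that `M` writes is a prefix of the infinite word `y`, and `M` writes arbitrarily
long words, then its output converges to `y`. -/
theorem output_convergesTo {y : ℕ → B} (h₁ : ∀ t, IsPre (M.written x t) y)
    (h₂ : ∀ k, ∃ t, k ≤ (M.written x t).length) :
    Word.ConvergesTo (fun k => M.output x k) (Word.inf y) := by
  refine Word.convergesTo_iff.mpr fun k => ?_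
  obtain ⟨t, ht⟩ := h₂ k
  refine ⟨(M.run x t).head + 1, fun n hn i hi => ?_⟩
  refine Word.concat_get?_eq_some_iff.mpr ⟨t, ?_⟩
  rw [flatMap_output_eq]
  · have hi' : i < (M.written x t).length := by omega
    rw [List.getElem?_eq_getElem hi', h₁ t i _ (List.getElem?_eq_getElem hi')]
  · intro s hs
    have : (M.run x s).head ≤ (M.run x t).head := M.head_mono x hs.le
    omega

/-- A machine all of whose states lie in `F` can be given the type of states `F`. -/
def restrict (F : Set Q) (h₀ : M.init ∈ F) (h : ∀ q ∈ F, ∀ a w, (M.act q a w).next ∈ F) :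
    Machine A B F W where
  init := ⟨M.init, h₀⟩
  act q a w := ⟨⟨(M.act q a w).next, h q q.2 a w⟩, (M.act q a w).write, (M.act q a w).move,
    (M.act q a w).advance, (M.act q a w).emit⟩

theorem restrict_run {F : Set Q} (h₀ : M.init ∈ F)
    (h : ∀ q ∈ F, ∀ a w, (M.act q a w).next ∈ F) (t : ℕ) :
    M.run x t = ⟨((M.restrict F h₀ h).run x t).state, ((M.restrict F h₀ h).run x t).head,
      ((M.restrict F h₀ h).run x t).work⟩ := by
  induction t with
  | zero => rfl
  | succ t ih =>
    rw [run, ih]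
    rfl

theorem restrict_written {F : Set Q} (h₀ : M.init ∈ F)
    (h : ∀ q ∈ F, ∀ a w, (M.act q a w).next ∈ F) (t : ℕ) :
    (M.restrict F h₀ h).written x t = M.written x t := by
  unfold written
  simp only [M.restrict_run x h₀ h]
  rfl

end Machine

/-! ### Running code on the working tape -/

namespace CodeTape

open Turing Turing.PartrecToTM2 StateTransition

instance : Finite K' := by
  refine Finite.of_surjective (fun i : Fin 4 => ![K'.main, K'.rev, K'.aux, K'.stack] i) ?_
  rintro (_ | _ | _ | _)
  · exact ⟨0, rfl⟩
  · exact ⟨1, rfl⟩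
  · exact ⟨2, rfl⟩
  · exact ⟨3, rfl⟩

/-- The tape alphabet of Mathlib's one-tape simulation of `ToPartrec.Code`. -/
abbrev Sym : Type := TM2to1.Γ' K' (fun _ => PartrecToTM2.Γ')

instance : Finite Sym := inferInstanceAs (Finite (Bool × (K' → Option PartrecToTM2.Γ')))

/-- Mathlib's one-tape simulation of `ToPartrec.Code` as a `TM1` program. -/
abbrev prog : TM2to1.Λ' K' (fun _ => PartrecToTM2.Γ') PartrecToTM2.Λ' (Option PartrecToTM2.Γ') →
    TM1.Stmt Sym (TM2to1.Λ' K' (fun _ => PartrecToTM2.Γ') PartrecToTM2.Λ'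
      (Option PartrecToTM2.Γ')) (Option PartrecToTM2.Γ') :=
  TM2to1.tr PartrecToTM2.tr

/-- The states of Mathlib's simulation of `ToPartrec.Code` as a `TM0` machine. -/
abbrev St : Type := TM1to0.Λ' prog

/-- Mathlib's simulation of `ToPartrec.Code` as a `TM0` machine. -/
abbrev mach : TM0.Machine Sym St := TM1to0.tr prog

/-- The state in which the execution of the label `l` starts. -/
def start (l : PartrecToTM2.Λ') : St := (some (prog (TM2to1.Λ'.normal l)), none)

/-- The halting state. -/
def haltState : St := (none, none)

/-- The tape `T` represents the contents `S` of the stacks. -/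
def Represents (S : K' → List PartrecToTM2.Γ') (T : Tape Sym) : Prop :=
  ∃ L : ListBlank (K' → Option PartrecToTM2.Γ'),
    (∀ k, L.map (Turing.proj k) = ListBlank.mk ((S k).map some).reverse) ∧
      T = Tape.mk' ∅ (TM2to1.addBottom L)

/-- The head rests on the bottom cell of the stacks. The control can thus see whether a given stack
is empty, which is how a running code communicates with it. -/
theorem Represents.head_eq {S : K' → List PartrecToTM2.Γ'} {T : Tape Sym} (h : Represents S T)
    (k : K') : T.head.2 k = (S k).reverse.head? := by
  obtain ⟨L, hL, rfl⟩ := h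
  have := TM2to1.stk_nth_val 0 (hL k)
  rw [Tape.mk'_head, ← ListBlank.nth_zero, TM2to1.addBottom_nth_snd, this,
    List.head?_eq_getElem?]

/-- A blank tape lacks the bottom marker, the `true` written here; writing it is the purpose of the
`boot` phase. -/
theorem represents_nil : Represents (K'.elim [] [] [] [])
    ((Tape.mk₁ [] : Tape Sym).write (true, fun _ => none)) := by
  refine ⟨ListBlank.mk [], fun k => ?_, ?_⟩
  · cases k <;> rfl
  · rfl

/-- The simulations of `TM2` by `TM1` and of `TM1` by `TM0` are composed. The local store is
required to be `none` at the end so that halting always occurs in the single state `haltState`; the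
label `.ret .halt` resets it. -/
theorem mach_reaches {l : PartrecToTM2.Λ'} {S S' : K' → List PartrecToTM2.Γ'} {T : Tape Sym}
    (h : Reaches (TM2.step PartrecToTM2.tr) ⟨some l, none, S⟩ ⟨none, none, S'⟩)
    (hT : Represents S T) :
    ∃ T', Represents S' T' ∧ Reaches (TM0.step mach) ⟨start l, T⟩ ⟨haltState, T'⟩ := by
  obtain ⟨L, hL, rfl⟩ := hT
  obtain ⟨c₁, h₁, r₁⟩ := tr_reaches (TM2to1.tr_respects PartrecToTM2.tr)
    (TM2to1.TrCfg.mk (q := some l) (v := none) L hL) h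
  obtain ⟨c₂, h₂, r₂⟩ := tr_reaches (TM1to0.tr_respects prog) rfl r₁
  cases h₁ with
  | mk L' hL' => exact ⟨_, ⟨L', hL', rfl⟩, by rw [← h₂] at r₂; exact r₂⟩

/-- A program that decrements the first number in the main stack if it is positive, and removes it
and puts a symbol on the auxiliary stack if it is zero. -/
def testLabel : PartrecToTM2.Λ' :=
  .pred (.push .aux (fun _ => some .bit0) (.ret .halt)) (.ret .halt)

/-- A program that clears the auxiliary stack and runs the code `c`. -/
def runLabel (c : ToPartrec.Code) : PartrecToTM2.Λ' :=
  .clear (fun _ => false) .aux (trNormal c .halt)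

theorem testLabel_zero (v : List ℕ) : Reaches (TM2.step PartrecToTM2.tr)
    ⟨some testLabel, none, K'.elim (trList (0 :: v)) [] [] []⟩
    ⟨none, none, K'.elim (trList v) [] [.bit0] []⟩ := by
  obtain ⟨s, hs⟩ := pred_ok (.push .aux (fun _ => some .bit0) (.ret .halt)) (.ret .halt) none
    (0 :: v) [] []
  refine hs.to_reflTransGen.trans ?_
  refine Relation.ReflTransGen.head (b := ⟨some (.ret .halt), s, K'.elim (trList v) [] [.bit0] []⟩)
    ?_ (Relation.ReflTransGen.single ?_)
  · simp [TM2.step, PartrecToTM2.tr, TM2.stepAux]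
  · simp [TM2.step, PartrecToTM2.tr, TM2.stepAux]

theorem testLabel_succ (n : ℕ) (v : List ℕ) : Reaches (TM2.step PartrecToTM2.tr)
    ⟨some testLabel, none, K'.elim (trList ((n + 1) :: v)) [] [] []⟩
    ⟨none, none, K'.elim (trList (n :: v)) [] [] []⟩ := by
  obtain ⟨s, hs⟩ := pred_ok (.push .aux (fun _ => some .bit0) (.ret .halt)) (.ret .halt) none
    ((n + 1) :: v) [] []
  refine hs.to_reflTransGen.trans (Relation.ReflTransGen.single ?_)
  simp [TM2.step, PartrecToTM2.tr, TM2.stepAux]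

/-- Compiled code expects all stacks but the main one to be empty, hence the preliminary clearing of
the symbol that a successful test may have left. The predicate is constantly false, so clearing
stops only at the end of the stack. -/
theorem runLabel_reaches {c : ToPartrec.Code} {v v' : List ℕ} (h : v' ∈ c.eval v)
    (a : List PartrecToTM2.Γ') : Reaches (TM2.step PartrecToTM2.tr)
    ⟨some (runLabel c), none, K'.elim (trList v) [] a []⟩
    ⟨none, none, K'.elim (trList v') [] [] []⟩ := by
  have h₁ := clear_ok (p := fun _ => false) (k := .aux) (q := trNormal c .halt) (s := none)
    (S := K'.elim (trList v) [] a []) (splitAtPred_false a)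
  rw [K'.elim_update_aux] at h₁
  refine h₁.to_reflTransGen.trans ?_
  have h₂ : PartrecToTM2.halt v' ∈ eval (TM2.step PartrecToTM2.tr) (PartrecToTM2.init c v) := by
    rw [PartrecToTM2.tr_eval]
    exact Part.mem_map _ h
  exact (mem_eval.mp h₂).1

/-- Finitely many states suffice to execute finitely many codes. -/
theorem exists_finite_support (C : Set ToPartrec.Code) (hC : C.Finite) :
    ∃ F : Set St, F.Finite ∧ haltState ∈ F ∧ start testLabel ∈ F ∧
      (∀ c ∈ C, start (runLabel c) ∈ F) ∧
      ∀ q ∈ F, ∀ a q' s, mach q a = some (q', s) → q' ∈ F := by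
  classical
  let S : Finset PartrecToTM2.Λ' :=
    trStmts₁ testLabel ∪ hC.toFinset.biUnion fun c =>
      trStmts₁ (runLabel c) ∪ codeSupp c .halt
  have hS₁ : trStmts₁ testLabel ⊆ S := Finset.subset_union_left
  have hS₂ : ∀ c ∈ C, trStmts₁ (runLabel c) ∪ codeSupp c .halt ⊆ S := fun c hc =>
    (Finset.subset_biUnion_of_mem (fun c => trStmts₁ (runLabel c) ∪ codeSupp c .halt)
      (hC.mem_toFinset.mpr hc)).trans Finset.subset_union_right
  have hS₃ : PartrecToTM2.Supports S S := by
    refine supports_union.mpr ⟨trStmts₁_supports ?_ hS₁, fun q hq => ?_⟩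
    · exact ⟨by simp [Λ'.Supports], by simp [Λ'.Supports]⟩
    · obtain ⟨c, hc, hq⟩ := Finset.mem_biUnion.mp hq
      have hc' := hS₂ c (hC.mem_toFinset.mp hc)
      have hk := Finset.union_subset_right hc'
      exact supports_union.mpr ⟨trStmts₁_supports (q := runLabel c)
        (show Λ'.Supports S (trNormal c .halt) from trNormal_supports hk)
        (Finset.union_subset_left hc'), codeSupp_supports hk⟩ q hq
  -- `TM2.Supports` demands that the default label belong to the support, so the default is chosen
  -- inside `S`.
  let i₂ : Inhabited PartrecToTM2.Λ' := ⟨testLabel⟩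
  have ss₂ : @TM2.Supports _ _ _ _ i₂ PartrecToTM2.tr S := ⟨hS₁ (trStmts₁_self _), hS₃⟩
  have ss₁ := TM2to1.tr_supports PartrecToTM2.tr ss₂
  have ss₀ := TM1to0.tr_supports prog ss₁
  have hmem : ∀ l ∈ S, start l ∈ TM1to0.trStmts prog (TM2to1.trSupp PartrecToTM2.tr S) := by
    intro l hl
    refine Finset.mem_product.mpr ⟨?_, Finset.mem_univ _⟩
    refine Finset.some_mem_insertNone.mpr (Finset.mem_biUnion.mpr
      ⟨TM2to1.Λ'.normal l, ?_, TM1.stmts₁_self⟩)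
    exact Finset.mem_biUnion.mpr ⟨l, hl, Finset.mem_insert_self _ _⟩
  refine ⟨TM1to0.trStmts prog (TM2to1.trSupp PartrecToTM2.tr S), Finset.finite_toSet _, ?_,
    hmem _ (hS₁ (trStmts₁_self _)), fun c hc => hmem _ ?_, fun q hq a q' s h => ss₀.2 h hq⟩
  · exact Finset.mem_product.mpr ⟨Multiset.mem_cons_self _ _, Finset.mem_univ _⟩
  · exact hS₂ c hc (Finset.mem_union_left _ (trStmts₁_self _))

end CodeTape

/-! ### An interactive machine that executes code between two input or output actions -/

namespace CodeTape

open Turing Turing.PartrecToTM2 StateTransition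

/-- The phases of the interactive machine: `boot`, before the working tape is prepared, `load`,
while the code that computes the next action is running, and `test i`, while it is tested whether
the action is the one with number `i`. -/
inductive Phase (n : ℕ) where
  | boot : Phase n
  | load : Phase n
  | test (i : Fin (n + 1)) : Phase n

instance (n : ℕ) : Finite (Phase n) := by
  refine Finite.of_surjective
    (fun o : Option (Option (Fin (n + 1))) => o.elim .boot fun o => o.elim .load .test) ?_
  rintro (_ | _ | i)
  · exact ⟨none, rfl⟩
  · exact ⟨some none, rfl⟩
  · exact ⟨some (some i), rfl⟩

/-- The code executed after the action number `i`, where `a` is the scanned input cell. -/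
def nextCode {A : Type*} {n : ℕ} (cI cE : ToPartrec.Code) (cR : A → ToPartrec.Code)
    (i : Fin (n + 1)) (a : Option A) : ToPartrec.Code :=
  if i = 0 then a.elim cI cR else cE

/-- The symbol written by the action number `i`: none for `i = 0`, which reads an input cell. -/
def emitOf {B : Type*} {n : ℕ} (e : Fin n → B) (i : Fin (n + 1)) : Option B :=
  Fin.cases none (fun j => some (e j)) i

/-- The action of the interactive machine when the code has halted. -/
noncomputable def control {A B : Type*} {n : ℕ} (e : Fin n → B) (cI cE : ToPartrec.Code)
    (cR : A → ToPartrec.Code) (ph : Phase n) (a : Option A) (w : Sym) :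
    Action B (Phase n × St) Sym :=
  match ph with
  | .boot => ⟨(.load, start (runLabel cI)), (true, fun _ => none), none, false, none⟩
  | .load => ⟨(.test 0, start testLabel), w, none, false, none⟩
  | .test i =>
    if w.2 K'.aux = none then ⟨(.test (i + 1), start testLabel), w, none, false, none⟩
    else ⟨(.load, start (runLabel (nextCode cI cE cR i a))), w, none, decide (i = 0), emitOf e i⟩

/-- The interactive machine, with infinitely many states. Between two actions, the code leaves the
number of the next action and the new internal state on the working tape. -/
noncomputable def interactive {A B : Type*} {n : ℕ} (e : Fin n → B) (cI cE : ToPartrec.Code)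
    (cR : A → ToPartrec.Code) : Machine A B (Phase n × St) Sym where
  init := (.boot, haltState)
  act q a w :=
    match mach q.2 w with
    | some (q', .move d) => ⟨(q.1, q'), w, some d, false, none⟩
    | some (q', .write w') => ⟨(q.1, q'), w', none, false, none⟩
    | none => control e cI cE cR q.1 a w

section Run

variable {A B : Type*} {n : ℕ} {e : Fin n → B} {cI cE : ToPartrec.Code}
  {cR : A → ToPartrec.Code} {x : Word A}

local notation "M" => interactive e cI cE cR

theorem run_of_step {t : ℕ} {ph : Phase n} {q : St} {T : Tape Sym} {h : ℕ} {c : TM0.Cfg Sym St}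
    (ht : (M).run x t = ⟨(ph, q), h, T⟩) (hc : c ∈ TM0.step mach ⟨q, T⟩) :
    (M).run x (t + 1) = ⟨(ph, c.q), h, c.Tape⟩ ∧ (M).written x (t + 1) = (M).written x t := by
  simp only [TM0.step, Option.mem_def, Option.map_eq_some_iff] at hc
  obtain ⟨⟨q', s⟩, hq, rfl⟩ := hc
  rw [Machine.written_succ, Machine.run, Machine.step, Machine.action, ht]
  cases s with
  | move d => simp [interactive, hq]
  | write w => simp [interactive, hq]

theorem run_of_reaches {t : ℕ} {ph : Phase n} {h : ℕ} {c c' : TM0.Cfg Sym St}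
    (hr : Reaches (TM0.step mach) c c') (ht : (M).run x t = ⟨(ph, c.q), h, c.Tape⟩) :
    ∃ t', (M).run x t' = ⟨(ph, c'.q), h, c'.Tape⟩ ∧ (M).written x t' = (M).written x t := by
  induction hr with
  | refl => exact ⟨t, ht, rfl⟩
  | tail _ hs ih =>
    obtain ⟨t', h₁, h₂⟩ := ih
    obtain ⟨h₃, h₄⟩ := run_of_step h₁ hs
    exact ⟨t' + 1, h₃, h₄.trans h₂⟩

variable (e cI cE cR x) in
/-- At time `t` the machine is in phase `ph` with its input head on cell `h`, it has written `out`,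
its code is in state `q`, and its working tape represents the stacks `S`. -/
def Snapshot (ph : Phase n) (q : St) (S : K' → List PartrecToTM2.Γ') (h : ℕ) (out : List B) :
    Prop :=
  ∃ t T, (M).run x t = ⟨(ph, q), h, T⟩ ∧ (M).written x t = out ∧ Represents S T

theorem Snapshot.exec {ph : Phase n} {l : PartrecToTM2.Λ'} {S S' : K' → List PartrecToTM2.Γ'}
    {h : ℕ} {out : List B} (hs : Snapshot e cI cE cR x ph (start l) S h out)
    (hr : Reaches (TM2.step PartrecToTM2.tr) ⟨some l, none, S⟩ ⟨none, none, S'⟩) :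
    Snapshot e cI cE cR x ph haltState S' h out := by
  obtain ⟨t, T, ht, hw, hT⟩ := hs
  obtain ⟨T', hT', hm⟩ := mach_reaches hr hT
  obtain ⟨t', ht', hw'⟩ := run_of_reaches hm ht
  exact ⟨t', T', ht', hw'.trans hw, hT'⟩

theorem Snapshot.halted {ph : Phase n} {S : K' → List PartrecToTM2.Γ'} {h : ℕ} {out : List B}
    (hs : Snapshot e cI cE cR x ph haltState S h out) :
    ∃ t T, Represents S T ∧ (M).run x (t + 1) =
      ⟨(control e cI cE cR ph (x.get? h) T.head).next,
        if (control e cI cE cR ph (x.get? h) T.head).advance then h + 1 else h,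
        match (control e cI cE cR ph (x.get? h) T.head).move with
        | none => T.write (control e cI cE cR ph (x.get? h) T.head).write
        | some d => (T.write (control e cI cE cR ph (x.get? h) T.head).write).move d⟩ ∧
      (M).written x (t + 1) = out ++ (control e cI cE cR ph (x.get? h) T.head).emit.toList := by
  obtain ⟨t, T, ht, hw, hT⟩ := hs
  refine ⟨t, T, hT, ?_, ?_⟩
  · rw [Machine.run, Machine.step, Machine.action, ht]
    rfl
  · rw [Machine.written_succ, hw, Machine.action, ht]
    rfl

theorem Snapshot.load {S : K' → List PartrecToTM2.Γ'} {h : ℕ} {out : List B}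
    (hs : Snapshot e cI cE cR x .load haltState S h out) :
    Snapshot e cI cE cR x (.test 0) (start testLabel) S h out := by
  obtain ⟨t, T, hT, h₁, h₂⟩ := hs.halted
  refine ⟨t + 1, T, ?_, ?_, hT⟩
  · rw [h₁]
    simp [control]
  · rw [h₂]
    simp [control]

theorem Snapshot.test_fail {i : Fin (n + 1)} {l : List PartrecToTM2.Γ'} {h : ℕ} {out : List B}
    (hs : Snapshot e cI cE cR x (.test i) haltState (K'.elim l [] [] []) h out) :
    Snapshot e cI cE cR x (.test (i + 1)) (start testLabel) (K'.elim l [] [] []) h out := by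
  obtain ⟨t, T, hT, h₁, h₂⟩ := hs.halted
  have hh : T.head.2 K'.aux = none := hT.head_eq K'.aux
  refine ⟨t + 1, T, ?_, ?_, hT⟩
  · rw [h₁]
    simp [control, hh]
  · rw [h₂]
    simp [control, hh]

theorem Snapshot.test_succeed {i : Fin (n + 1)} {l : List PartrecToTM2.Γ'} {h : ℕ} {out : List B}
    (hs : Snapshot e cI cE cR x (.test i) haltState (K'.elim l [] [.bit0] []) h out) :
    Snapshot e cI cE cR x .load (start (runLabel (nextCode cI cE cR i (x.get? h))))
      (K'.elim l [] [.bit0] []) (if i = 0 then h + 1 else h) (out ++ (emitOf e i).toList) := by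
  obtain ⟨t, T, hT, h₁, h₂⟩ := hs.halted
  have hh : T.head.2 K'.aux = some .bit0 := hT.head_eq K'.aux
  refine ⟨t + 1, T, ?_, ?_, hT⟩
  · rw [h₁]
    simp [control, hh]
  · rw [h₂]
    simp [control, hh]

/-- Each failed test decrements the number on the stack and increments the index of the phase, so
their sum is invariant and the test succeeds exactly at the number of the action. The bound `hi`
prevents the index in `Fin (n + 1)` from wrapping around. -/
theorem Snapshot.test {m k : ℕ} {i : Fin (n + 1)} (hi : (i : ℕ) + k ≤ n) {h : ℕ} {out : List B}
    (hs : Snapshot e cI cE cR x (.test i) (start testLabel) (K'.elim (trList [k, m]) [] [] [])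
      h out) :
    Snapshot e cI cE cR x (.test (Fin.ofNat (n + 1) (i + k))) haltState
      (K'.elim (trList [m]) [] [.bit0] []) h out := by
  induction k generalizing i with
  | zero =>
    have : Fin.ofNat (n + 1) ((i : ℕ) + 0) = i := by
      ext
      simp
    rw [this]
    exact hs.exec (testLabel_zero [m])
  | succ k ih =>
    have h₁ : ((i + 1 : Fin (n + 1)) : ℕ) = i + 1 := by
      rw [Fin.val_add_one_of_lt (Fin.lt_def.mpr (by simp; omega))]
    have := ih (i := i + 1) (by omega) ((hs.exec (testLabel_succ k [m])).test_fail)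
    rw [h₁, show (i : ℕ) + 1 + k = i + (k + 1) by omega] at this
    exact this

/-- One full cycle: the number of the action is identified, the action is performed, and the code
for the next one is run. That code is selected by the cell scanned before the head advances. -/
theorem Snapshot.round {i : Fin (n + 1)} {m : ℕ} {v : List ℕ} {h : ℕ} {out : List B}
    (hs : Snapshot e cI cE cR x .load haltState (K'.elim (trList [(i : ℕ), m]) [] [] []) h out)
    (hv : v ∈ (nextCode cI cE cR i (x.get? h)).eval [m]) :
    Snapshot e cI cE cR x .load haltState (K'.elim (trList v) [] [] [])
      (if i = 0 then h + 1 else h) (out ++ (emitOf e i).toList) := by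
  have h₁ := hs.load.test (by simp; omega)
  have h₂ : Fin.ofNat (n + 1) (((0 : Fin (n + 1)) : ℕ) + i) = i := by
    ext
    simp
  rw [h₂] at h₁
  exact h₁.test_succeed.exec (runLabel_reaches hv _)

theorem snapshot_boot {v : List ℕ} (hv : v ∈ cI.eval []) :
    Snapshot e cI cE cR x .load haltState (K'.elim (trList v) [] [] []) 0 [] := by
  refine Snapshot.exec (l := runLabel cI) (S := K'.elim [] [] [] []) ⟨1, _, ?_, rfl, represents_nil⟩
    (runLabel_reaches hv [])
  rfl

end Run

theorem exists_code_of_computable {f : ℕ → ℕ} (hf : Computable f) :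
    ∃ c : ToPartrec.Code, ∀ m, c.eval [m] = pure [f m] := by
  obtain ⟨c, hc⟩ := ToPartrec.Code.exists_code
    (Nat.Partrec'.part_iff₁ (f := fun n => Part.some (f n)) |>.mpr hf)
  refine ⟨c, fun m => ?_⟩
  have := hc (m ::ᵥ List.Vector.nil)
  simp only [List.Vector.head_cons] at this
  rw [show [m] = (m ::ᵥ List.Vector.nil : List.Vector ℕ 1).1 from rfl, this]
  simp

theorem exists_code_pair {f g : ℕ → ℕ} (hf : Computable f) (hg : Computable g) :
    ∃ c : ToPartrec.Code, ∀ m, [f m, g m] ∈ c.eval [m] := by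
  obtain ⟨c, hc⟩ := exists_code_of_computable hf
  obtain ⟨d, hd⟩ := exists_code_of_computable hg
  refine ⟨c.cons d, fun m => ?_⟩
  simp [hc, hd]

/-- Only finitely many codes are ever started, one per input symbol and two more, because `A` is
finite. -/
theorem interactive_closed {A B : Type*} [Finite A] {n : ℕ} (e : Fin n → B)
    (cI cE : ToPartrec.Code) (cR : A → ToPartrec.Code) :
    ∃ F : Set (Phase n × St), F.Finite ∧ (interactive e cI cE cR).init ∈ F ∧
      ∀ q ∈ F, ∀ a w, ((interactive e cI cE cR).act q a w).next ∈ F := by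
  obtain ⟨F, hF, hs, ht, hc, hm⟩ := exists_finite_support (insert cI (insert cE (Set.range cR)))
    (((Set.finite_range cR).insert _).insert _)
  refine ⟨Set.univ ×ˢ F, Set.finite_univ.prod hF, ⟨trivial, hs⟩, ?_⟩
  rintro ⟨ph, q⟩ hq a w
  refine ⟨trivial, ?_⟩
  have hq : q ∈ F := hq.2
  rcases hqw : mach q w with _ | ⟨q', s | s⟩
  · simp only [interactive, hqw, control]
    rcases ph with _ | _ | i
    · exact hc _ (Set.mem_insert _ _)
    · exact ht
    · simp only
      split_ifs
      · exact ht
      · refine hc _ ?_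
        unfold nextCode
        split_ifs
        · rcases a with _ | a
          · exact Set.mem_insert _ _
          · exact Or.inr (Or.inr ⟨a, rfl⟩)
        · exact Or.inr (Or.inl rfl)
  · simpa only [interactive, hqw] using hm q hq w q' _ hqw
  · simpa only [interactive, hqw] using hm q hq w q' _ hqw

end CodeTape

/-! ### From a computable function on finite prefixes to a machine -/

namespace CodeTape

open Turing Turing.PartrecToTM2 Encodable

/-- The working tape holds numbers, so internal states are passed between codes through `encode`.
The value `0` on numbers that code nothing is never used. -/
theorem computable_decode_elim {α β : Type*} [Primcodable α] [Primcodable β] {f : α → β}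
    (hf : Computable f) :
    Computable fun m : ℕ => (decode (α := α) m).elim 0 fun a => encode (f a) := by
  have h : Computable₂ fun (_ : ℕ) (a : α) => encode (f a) :=
    (Computable.encode.comp (hf.comp Computable.snd)).to₂
  refine (Computable.option_casesOn Computable.decode (Computable.const 0) h).of_eq fun m => ?_
  cases decode (α := α) m <;> rfl

end CodeTape

open CodeTape Encodable in
/-- Suppose that a computable function maps each finite prefix of `x` to a prefix of `y`, and that
these prefixes are arbitrarily long. Then a machine computes `y` from `x`; the machine depends on
the function only. -/
theorem exists_machine {A B : Type*} [Finite A] [Finite B] [Primcodable A] [Primcodable B]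
    {g : List A → List B} (hg : Computable g) :
    ∃ (Q W : Type) (_ : Finite Q) (_ : Finite W) (_ : Inhabited W) (M : Machine A B Q W),
      ∀ (x : ℕ → A) (y : ℕ → B), (∀ k, IsPre (g (takePre k x)) y) →
        (∀ k, ∃ m, k ≤ (g (takePre m x)).length) →
        Word.ConvergesTo (fun k => M.output (Word.inf x) k) (Word.inf y) := by
  obtain ⟨n, ⟨e⟩⟩ := Finite.exists_equiv_fin B
  -- The internal state consists of the cells read so far and the number of symbols written. Action
  -- `0` reads a cell and is chosen when `g` promises no further symbol; action `e b + 1` writes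
  -- `b`.
  let act : List A × ℕ → ℕ := fun s => ((g s.1)[s.2]?).elim 0 fun b => e b + 1
  have hact : Computable act := by
    have h₁ : Computable fun s : List A × ℕ => (g s.1)[s.2]? :=
      Computable.list_getElem?.comp (hg.comp Computable.fst) Computable.snd
    have h₂ : Primrec fun b : B => (e b : ℕ) + 1 := Primrec.dom_finite _
    refine (Computable.option_casesOn h₁ (Computable.const 0)
      (h₂.to_comp.comp Computable.snd).to₂).of_eq fun s => ?_
    change _ = ((g s.1)[s.2]?).elim 0 fun b => (e b : ℕ) + 1
    cases (g s.1)[s.2]? <;> rfl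
  have key : ∀ F : List A × ℕ → List A × ℕ, Computable F →
      ∃ c : Turing.ToPartrec.Code, ∀ s, [act (F s), encode (F s)] ∈ c.eval [encode s] := by
    intro F hF
    obtain ⟨c, hc⟩ := exists_code_pair (computable_decode_elim (hact.comp hF))
      (computable_decode_elim hF)
    refine ⟨c, fun s => ?_⟩
    simpa using hc (encode s)
  obtain ⟨c₀, hc₀⟩ := exists_code_pair (Computable.const (act ([], 0)))
    (Computable.const (encode (([], 0) : List A × ℕ)))
  obtain ⟨cE, hcE⟩ := key (fun s => (s.1, s.2 + 1))
    (Computable.fst.pair (Computable.succ.comp Computable.snd))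
  choose cR hcR using fun a : A => key (fun s => (s.1 ++ [a], s.2))
    ((Computable.list_append.comp Computable.fst (Computable.const [a])).pair Computable.snd)
  -- The tape is empty at the start, and `zero'` supplies the argument that `c₀` expects and
  -- ignores.
  let cI := c₀.comp .zero'
  have hcI : [act ([], 0), encode (([], 0) : List A × ℕ)] ∈ cI.eval [] := by
    refine Part.mem_bind (a := [0]) ?_ (hc₀ 0)
    simp
  let e' : Fin n → B := e.symm
  obtain ⟨F, hF, hF₀, hF₁⟩ := interactive_closed e' cI cE cR
  have : Finite F := hF
  refine ⟨F, Sym, inferInstance, inferInstance, inferInstance,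
    (interactive e' cI cE cR).restrict F hF₀ hF₁, fun x y h₁ h₂ => ?_⟩
  let Inv : ℕ → ℕ → Prop := fun h j => Snapshot e' cI cE cR (Word.inf x) .load haltState
    (Turing.PartrecToTM2.K'.elim
      (Turing.PartrecToTM2.trList [act (takePre h x, j), encode (takePre h x, j)]) [] [] [])
    h (takePre j y)
  have inv_zero : Inv 0 0 := snapshot_boot hcI
  have inv_read : ∀ h j, (g (takePre h x)).length ≤ j → Inv h j → Inv (h + 1) j := by
    intro h j hj hi
    have ha : act (takePre h x, j) = ((0 : Fin (n + 1)) : ℕ) := by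
      simp [act, List.getElem?_eq_none hj]
    have hi' := hi
    simp only [Inv] at hi'
    rw [ha] at hi'
    have := hi'.round (v := [act (takePre (h + 1) x, j), encode (takePre (h + 1) x, j)]) (by
      rw [takePre_succ]
      exact hcR (x h) (takePre h x, j))
    simpa [emitOf, Inv] using this
  have inv_emit : ∀ h j, j < (g (takePre h x)).length → Inv h j → Inv h (j + 1) := by
    intro h j hj hi
    have hb := List.getElem?_eq_getElem hj
    have ha : act (takePre h x, j) = ((Fin.succ (e (y j)) : Fin (n + 1)) : ℕ) := by
      rw [h₁ h j _ hb]
      simp [act, hj]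
    have hi' := hi
    simp only [Inv] at hi'
    rw [ha] at hi'
    have := hi'.round (v := [act (takePre h x, j + 1), encode (takePre h x, j + 1)]) (by
      rw [nextCode, if_neg (Fin.succ_ne_zero _)]
      exact hcE (takePre h x, j))
    rw [if_neg (Fin.succ_ne_zero _)] at this
    simpa [emitOf, e', Inv, takePre_succ] using this
  have inv_emits : ∀ h j, Inv h j → ∃ j', (g (takePre h x)).length ≤ j' ∧ Inv h j' := by
    intro h j hi
    obtain ⟨d, hd⟩ : ∃ d, (g (takePre h x)).length ≤ j + d := ⟨_, Nat.le_add_left _ _⟩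
    induction d generalizing j with
    | zero => exact ⟨j, hd, hi⟩
    | succ d ih =>
      by_cases hj : j < (g (takePre h x)).length
      · exact ih (j + 1) (inv_emit h j hj hi) (by omega)
      · exact ⟨j, not_lt.mp hj, hi⟩
  have inv_all : ∀ h, ∃ j, (g (takePre h x)).length ≤ j ∧ Inv h j := by
    intro h
    induction h with
    | zero => exact inv_emits 0 0 inv_zero
    | succ h ih =>
      obtain ⟨j, hj, hi⟩ := ih
      exact inv_emits _ _ (inv_read h j hj hi)
  refine Machine.output_convergesTo _ _ (fun t => ?_) (fun k => ?_)
  · rw [Machine.restrict_written]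
    -- At time `t'` the head is on cell `t`, so `t ≤ t'`, and what is written at time `t` is a
    -- prefix of what is written then.
    obtain ⟨j, -, t', T, ht', hw, -⟩ := inv_all t
    have := (interactive e' cI cE cR).head_le (Word.inf x) t'
    rw [ht'] at this
    refine IsPre.of_prefix ?_ (Machine.written_prefix _ _ this)
    rw [hw]
    exact isPre_takePre _ _
  · obtain ⟨m, hm⟩ := h₂ k
    obtain ⟨j, hj, t, T, ht, hw, -⟩ := inv_all m
    refine ⟨t, ?_⟩
    rw [Machine.restrict_written, hw, takePre_length]
    omega

/-! ### Infinite words with a finite prefix -/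

/-- The infinite word that consists of the finite word `l` followed by `y`. -/
def appendInf {α : Type*} (l : List α) (y : ℕ → α) : ℕ → α :=
  fun i => (l[i]?).getD (y (i - l.length))

theorem isPre_appendInf {α : Type*} (l : List α) (y : ℕ → α) : IsPre l (appendInf l y) := by
  intro i a hi
  simp [appendInf, hi]

theorem appendInf_shift {α : Type*} (l : List α) (y : ℕ → α) :
    (fun i => appendInf l y (l.length + i)) = y := by
  funext i
  simp [appendInf]

/-! ### Matching a word against an expected prefix -/

section Consume

variable {α β : Type*}

/-- The infinite word `y` has the prefix expected by `vs`, where `none` is never satisfied. -/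
def Fits (vs : Option (List α)) (y : ℕ → α) : Prop := ∃ v, vs = some v ∧ IsPre v y

open Classical in
/-- What is still expected of an infinite word that has to begin with `l` after the letter `b`. -/
noncomputable def consumeOne (l : List α) (b : α) : Option (List α) :=
  if l = [] ∨ l.head? = some b then some l.tail else none

/-- What is still expected of an infinite word after the finite word `o`. -/
noncomputable def consume (o : List α) (vs : Option (List α)) : Option (List α) :=
  o.foldl (fun vs b => vs.bind fun l => consumeOne l b) vs

theorem consumeOne_eq_some_iff {l l' : List α} {b : α} :
    consumeOne l b = some l' ↔ (l = [] ∨ l.head? = some b) ∧ l' = l.tail := by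
  unfold consumeOne
  split_ifs with h
  · simp [h, eq_comm]
  · simp [h]

theorem isPre_iff_tail {l : List α} {y : ℕ → α} :
    IsPre l y ↔ (l = [] ∨ l.head? = some (y 0)) ∧ IsPre l.tail (fun i => y (i + 1)) := by
  cases l with
  | nil => simp
  | cons a l => simp [isPre_cons, eq_comm]

/-- An exhausted expectation `some []` accepts every further letter, and a mismatch `none` is
permanent; so matching can be carried out block by block along a run. -/
theorem fits_consume {o : List α} {vs : Option (List α)} {y : ℕ → α} (ho : IsPre o y) :
    Fits (consume o vs) (fun i => y (o.length + i)) ↔ Fits vs y := by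
  induction o generalizing vs y with
  | nil => simp [consume]
  | cons b o ih =>
    obtain ⟨hb, ho⟩ := isPre_cons.mp ho
    have := ih (vs := vs.bind fun l => consumeOne l b) ho
    have h₂ : Fits (vs.bind fun l => consumeOne l b) (fun i => y (i + 1)) ↔ Fits vs y := by
      rcases vs with _ | l
      · simp [Fits]
      · simp only [Fits, Option.bind_some, consumeOne_eq_some_iff, Option.some.injEq,
          exists_eq_left']
        rw [isPre_iff_tail (l := l), hb]
        constructor
        · rintro ⟨v, ⟨h, rfl⟩, h'⟩
          exact ⟨h, h'⟩
        · rintro ⟨h, h'⟩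
          exact ⟨_, ⟨h, rfl⟩, h'⟩
    rw [← h₂, ← this]
    simp only [consume, List.foldl_cons, List.length_cons]
    simp only [add_right_comm]

/-- What remains expected is a suffix of the original expectation. It therefore introduces no new
data and takes finitely many values. -/
theorem consume_eq_some {o : List α} {vs : Option (List α)} {v' : List α}
    (h : consume o vs = some v') : ∃ v, vs = some v ∧ v' = v.drop o.length := by
  induction o generalizing vs with
  | nil => exact ⟨v', h, rfl⟩
  | cons b o ih =>
    obtain ⟨w, hw, hv⟩ := ih (vs := vs.bind fun l => consumeOne l b) h
    rw [Option.bind_eq_some_iff] at hw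
    obtain ⟨l, hl, hw⟩ := hw
    obtain ⟨-, rfl⟩ := consumeOne_eq_some_iff.mp hw
    exact ⟨l, hl, by rw [hv, List.drop_tail, List.length_cons]⟩

theorem consumeOne_map {f : α → β} (hf : Function.Injective f) (l : List α) (b : α) :
    consumeOne (l.map f) (f b) = (consumeOne l b).map (List.map f) := by
  have h' : (l.map f = [] ∨ (l.map f).head? = some (f b)) ↔ (l = [] ∨ l.head? = some b) := by
    cases l <;> simp [hf.eq_iff]
  unfold consumeOne
  by_cases h : l = [] ∨ l.head? = some b
  · rw [if_pos h, if_pos (h'.mpr h), Option.map_some, List.map_tail]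
  · rw [if_neg h, if_neg (mt h'.mp h), Option.map_none]

theorem consume_map {f : α → β} (hf : Function.Injective f) (o : List α)
    (vs : Option (List α)) :
    consume (o.map f) (vs.map (List.map f)) = (consume o vs).map (List.map f) := by
  induction o generalizing vs with
  | nil => rfl
  | cons b o ih =>
    have h : (vs.map (List.map f)).bind (fun l => consumeOne l (f b)) =
        (vs.bind fun l => consumeOne l b).map (List.map f) := by
      rcases vs with _ | l
      · rfl
      · exact consumeOne_map hf l b
    have := ih (vs.bind fun l => consumeOne l b)
    rw [← h] at this
    exact this

end Consume

/-! ### Runs of register transducers -/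

section Runs

variable {S G Q R D D' : Type*}

open Classical in
/-- The update of the valuation `τ` by the transition `t` reading the datum `d`. -/
noncomputable def Transition.update (t : Transition S G Q R) (τ : R → D) (d : D) : R → D :=
  fun r => if r ∈ t.asgn then d else τ r

/-- The output of the transition `t` when it leads to the valuation `τ`. -/
def Transition.word (t : Transition S G Q R) (τ : R → D) : List (G × D) :=
  t.out.map fun p => (p.1, τ p.2)

theorem NRT.step_iff {T : NRT S G Q R} {c c' : Q × (R → D)} {l : S × D} {w : List (G × D)} :
    T.Step c l w c' ↔ ∃ t ∈ T.trans, t.src = c.1 ∧ t.label = l.1 ∧ t.test.Sat c.2 l.2 ∧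
      c' = (t.dst, t.update c.2 l.2) ∧ w = t.word (t.update c.2 l.2) := by
  constructor
  · rintro ⟨t, ht, h₁, h₂, h₃, h₄, h₅, h₆⟩
    have : c'.2 = t.update c.2 l.2 := by
      funext r
      unfold Transition.update
      split_ifs with hr
      · exact (h₅ r).1 hr
      · exact (h₅ r).2 hr
    exact ⟨t, ht, h₁, h₃, h₄, Prod.ext h₂.symm this, by rw [h₆, ← this]; rfl⟩
  · rintro ⟨t, ht, h₁, h₃, h₄, rfl, rfl⟩
    refine ⟨t, ht, h₁, rfl, h₃, h₄, fun r => ⟨fun hr => ?_, fun hr => ?_⟩, rfl⟩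
    · simp [Transition.update, hr]
    · simp [Transition.update, hr]

theorem Transition.update_comp (t : Transition S G Q R) (h : D → D') (τ : R → D) (d : D) :
    t.update (h ∘ τ) (h d) = h ∘ t.update τ d := by
  funext r
  simp only [Transition.update, Function.comp]
  split_ifs <;> rfl

theorem Transition.word_comp (t : Transition S G Q R) (h : D → D') (τ : R → D) :
    t.word (h ∘ τ) = (t.word τ).map (Prod.map id h) := by
  simp [Transition.word]

theorem Test.sat_comp {h : D → D'} (hh : Function.Injective h) {φ : Test R} {τ : R → D} {d : D} :
    φ.Sat (h ∘ τ) (h d) ↔ φ.Sat τ d := by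
  induction φ with
  | top => rfl
  | bot => rfl
  | eq r => exact hh.eq_iff
  | ne r => exact hh.ne_iff
  | conj φ ψ h₁ h₂ => exact and_congr h₁ h₂
  | disj φ ψ h₁ h₂ => exact or_congr h₁ h₂
  | neg φ h₁ => exact not_congr h₁

/-- The configurations `ρ` and the outputs `o` form an accepting run of `T` (whose first
configuration is arbitrary) with input `u` and output `v`. -/
structure NRT.IsRun (T : NRT S G Q R) (ρ : ℕ → Q × (R → D)) (o : ℕ → List (G × D))
    (u : ℕ → S × D) (v : ℕ → G × D) : Prop where
  step : ∀ n, T.Step (ρ n) (u n) (o n) (ρ (n + 1))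
  accept : ∃ q ∈ T.accepting, {n | (ρ n).1 = q}.Infinite
  out : Word.concat o = Word.inf v

/-- Some accepting run of `T` from the configuration `c` has input `u` and output `v`. -/
def NRT.RelFrom (T : NRT S G Q R) (c : Q × (R → D)) (u : ℕ → S × D) (v : ℕ → G × D) : Prop :=
  ∃ ρ o, ρ 0 = c ∧ T.IsRun ρ o u v

theorem NRT.rel_iff {T : NRT S G Q R} {d₀ : D} {u : ℕ → S × D} {v : ℕ → G × D} :
    T.Rel d₀ u v ↔ T.RelFrom (T.init, fun _ => d₀) u v := by
  constructor
  · rintro ⟨ρ, o, h₁, h₂, h₃, h₄⟩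
    exact ⟨ρ, o, h₁, h₂, h₃, h₄⟩
  · rintro ⟨ρ, o, h₁, h₂, h₃, h₄⟩
    exact ⟨ρ, o, h₁, h₂, h₃, h₄⟩

theorem infinite_setOf_succ {p : ℕ → Prop} : {n | p (n + 1)}.Infinite ↔ {n | p n}.Infinite := by
  simp only [← Nat.frequently_atTop_iff_infinite]
  constructor
  · intro h
    exact (Filter.tendsto_add_atTop_nat 1).frequently h
  · intro h
    rw [← Filter.map_add_atTop_eq_nat 1] at h
    exact h

theorem concat_eq_inf_succ {α : Type*} {o : ℕ → List α} {v : ℕ → α} :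
    Word.concat o = Word.inf v ↔ IsPre (o 0) v ∧
      Word.concat (fun n => o (n + 1)) = Word.inf fun i => v ((o 0).length + i) := by
  rw [Word.concat_eq_inf_iff, Word.concat_eq_inf_iff]
  constructor
  · rintro ⟨h₁, h₂⟩
    refine ⟨by simpa using h₁ 1, fun n => ?_, fun k => ?_⟩
    · have := h₁ (n + 1)
      rw [flatMap_range_succ'] at this
      exact (isPre_append.mp this).2
    · obtain ⟨n, hn⟩ := h₂ ((o 0).length + k)
      refine ⟨n, ?_⟩
      have := (prefix_flatMap_range (v := o) (Nat.le_succ n)).length_le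
      rw [Nat.succ_eq_add_one, flatMap_range_succ', List.length_append] at this
      omega
  · rintro ⟨h₀, h₁, h₂⟩
    refine ⟨fun n => ?_, fun k => ?_⟩
    · cases n with
      | zero => simp
      | succ n =>
        rw [flatMap_range_succ']
        exact isPre_append.mpr ⟨h₀, h₁ n⟩
    · obtain ⟨n, hn⟩ := h₂ k
      refine ⟨n + 1, ?_⟩
      rw [flatMap_range_succ', List.length_append]
      omega

theorem NRT.IsRun.tail {T : NRT S G Q R} {ρ : ℕ → Q × (R → D)} {o : ℕ → List (G × D)}
    {u : ℕ → S × D} {v : ℕ → G × D} (h : T.IsRun ρ o u v) :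
    T.IsRun (fun n => ρ (n + 1)) (fun n => o (n + 1)) (fun n => u (n + 1))
      (fun i => v ((o 0).length + i)) where
  step n := h.step (n + 1)
  accept := by
    obtain ⟨q, hq, hi⟩ := h.accept
    exact ⟨q, hq, infinite_setOf_succ (p := fun n => (ρ n).1 = q) |>.mpr hi⟩
  out := (concat_eq_inf_succ.mp h.out).2

theorem NRT.RelFrom.cons {T : NRT S G Q R} {c c' : Q × (R → D)} {u : ℕ → S × D} {v : ℕ → G × D}
    {l : S × D} {w : List (G × D)} (hs : T.Step c l w c') (h : T.RelFrom c' u v) :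
    T.RelFrom c (appendInf [l] u) (appendInf w v) := by
  obtain ⟨ρ, o, h₀, h⟩ := h
  have hu : ∀ n, appendInf [l] u (n + 1) = u n := by simp [appendInf]
  refine ⟨fun n => n.casesOn c ρ, fun n => n.casesOn w o, rfl, ⟨fun n => ?_, ?_, ?_⟩⟩
  · cases n with
    | zero => simpa [h₀, appendInf] using hs
    | succ n => simpa [hu] using h.step n
  · obtain ⟨q, hq, hi⟩ := h.accept
    exact ⟨q, hq, infinite_setOf_succ.mp hi⟩
  · exact concat_eq_inf_succ.mpr ⟨isPre_appendInf w v, by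
      change Word.concat o = Word.inf fun i => appendInf w v (w.length + i)
      rw [appendInf_shift]
      exact h.out⟩

/-- Transitions only compare data for equality and copy them, so an injective renaming carries runs
to runs. All changes of data in the proof rest on this. -/
theorem NRT.RelFrom.map {T : NRT S G Q R} {c : Q × (R → D)} {u : ℕ → S × D} {v : ℕ → G × D}
    {h : D → D'} (hh : Function.Injective h) (hr : T.RelFrom c u v) :
    T.RelFrom (c.1, h ∘ c.2) (Prod.map id h ∘ u) (Prod.map id h ∘ v) := by
  obtain ⟨ρ, o, rfl, hr⟩ := hr
  refine ⟨fun n => ((ρ n).1, h ∘ (ρ n).2), fun n => (o n).map (Prod.map id h), rfl, ?_, ?_, ?_⟩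
  · intro n
    obtain ⟨t, ht, h₁, h₂, h₃, h₄, h₅⟩ := NRT.step_iff.mp (hr.step n)
    refine NRT.step_iff.mpr ⟨t, ht, h₁, h₂, (Test.sat_comp hh).mpr h₃, ?_, ?_⟩
    · simp only [h₄, Function.comp_apply, Prod.map_snd, t.update_comp h]
    · simp only [h₅, Function.comp_apply, Prod.map_snd, t.update_comp h, t.word_comp h]
  · exact hr.accept
  · obtain ⟨h₁, h₂⟩ := Word.concat_eq_inf_iff.mp hr.out
    refine Word.concat_eq_inf_iff.mpr ⟨fun n => ?_, fun k => ?_⟩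
    · rw [← List.map_flatMap]
      exact (h₁ n).map _
    · obtain ⟨n, hn⟩ := h₂ k
      exact ⟨n, by rwa [← List.map_flatMap, List.length_map]⟩

theorem NRT.Rel.map {T : NRT S G Q R} {d₀ : D} {u : ℕ → S × D} {v : ℕ → G × D}
    {h : D → D'} (hh : Function.Injective h) (hr : T.Rel d₀ u v) :
    T.Rel (h d₀) (Prod.map id h ∘ u) (Prod.map id h ∘ v) :=
  NRT.rel_iff.mpr ((NRT.rel_iff.mp hr).map hh)

/-- Some infinite input has an accepting run with an infinite output from the state `q` and the
valuation `τ`. -/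
def NRT.Live (T : NRT S G Q R) (q : Q) (τ : R → D) : Prop := ∃ u v, T.RelFrom (q, τ) u v

end Runs

/-! ### Certificates

A certificate is a finite set of configurations, over the data `ℕ`, that is closed under all
transitions and shows that all accepting runs whose input begins with a given finite word `u` have
an output that begins with a given finite word `v`. -/

section Certificates

variable {S G Q R : Type*}

/-- A configuration of a transducer over the data `ℕ` together with the part of an imposed prefix
that is still to be read, and the part of an expected prefix that is still to be output; the latter
is `none` after a mismatch. -/
abbrev Conf (S G Q R : Type*) := List (S × ℕ) × Q × (R → ℕ) × Option (List (G × ℕ))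

/-- The transition `t` is possible in `c` when the datum is `d`. -/
def Transition.Applies (t : Transition S G Q R) (c : Conf S G Q R) (d : ℕ) : Prop :=
  t.src = c.2.1 ∧ t.test.Sat c.2.2.1 d ∧ (c.1 = [] ∨ c.1.head? = some (t.label, d))

/-- The effect of the transition `t` on `c` when the datum is `d`. -/
noncomputable def Transition.next (t : Transition S G Q R) (c : Conf S G Q R) (d : ℕ) :
    Conf S G Q R :=
  (c.1.tail, t.dst, t.update c.2.2.1 d, consume (t.word (t.update c.2.2.1 d)) c.2.2.2)

/-- No configuration in `X` is bad, and `X` is closed under transitions with data below `m`. -/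
def NRT.Closed (T : NRT S G Q R) (X : List (Conf S G Q R)) (m : ℕ) : Prop :=
  ∀ c ∈ X, ¬ (c.1 = [] ∧ c.2.2.2 = none ∧ T.Live c.2.1 c.2.2.1) ∧
    ∀ d < m, ∀ t ∈ T.trans, t.Applies c d → t.next c d ∈ X

/-- `X` and `m` certify that the outputs of all accepting runs of `T` with an input that begins
with `u` begin with `v`. -/
def NRT.Certifies (T : NRT S G Q R) (n₀ : ℕ) (u : List (S × ℕ)) (v : List (G × ℕ))
    (X : List (Conf S G Q R)) (m : ℕ) : Prop :=
  (∀ p ∈ u, p.2 < m) ∧ (∀ p ∈ v, p.2 < m) ∧ n₀ < m ∧ (u, T.init, (fun _ => n₀), some v) ∈ X ∧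
    T.Closed X (m + Nat.card R + 1)

/-- Up to a permutation of the data that fixes those below `m₀`, some configuration in `X` has the
given components. -/
def Shadow (X : List (Conf S G Q R)) (m₀ m : ℕ) (us : List (S × ℕ)) (q : Q) (τ : R → ℕ)
    (vs : Option (List (G × ℕ))) : Prop :=
  ∃ π : Equiv.Perm ℕ, (∀ i < m₀, π i = i) ∧ (us, q, π ∘ τ, vs) ∈ X ∧ (∀ r, π (τ r) < m) ∧
    (∀ p ∈ us, p.2 < m₀) ∧ ∀ v, vs = some v → ∀ p ∈ v, p.2 < m₀

/-- The registers occupy at most `Nat.card R` of the `Nat.card R + 1` values in the interval. This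
explains the bound on data in `NRT.Certifies`. -/
theorem exists_fresh [Finite R] (τ : R → ℕ) (m₀ : ℕ) :
    ∃ f, m₀ ≤ f ∧ f < m₀ + Nat.card R + 1 ∧ ∀ r, τ r ≠ f := by
  classical
  have := Fintype.ofFinite R
  by_contra! hc
  have h : Finset.Ico m₀ (m₀ + Nat.card R + 1) ⊆ Finset.univ.image τ := by
    intro f hf
    obtain ⟨h₁, h₂⟩ := Finset.mem_Ico.mp hf
    obtain ⟨r, hr⟩ := hc f h₁ h₂
    exact Finset.mem_image.mpr ⟨r, Finset.mem_univ _, hr⟩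
  have h₁ := (Finset.card_le_card h).trans Finset.card_image_le
  rw [Nat.card_Ico, Finset.card_univ, ← Nat.card_eq_fintype_card] at h₁
  omega

/-- If the image of `d` is too large, it is swapped with a fresh value. That value is at least `m₀`
and is held by no register, so neither the fixed data nor the renamed registers move. -/
theorem exists_perm_lt [Finite R] (τ : R → ℕ) (m₀ d : ℕ) (π : Equiv.Perm ℕ)
    (h₀ : ∀ i < m₀, π i = i) (h₁ : ∀ r, π (τ r) < m₀ + Nat.card R + 1) :
    ∃ π' : Equiv.Perm ℕ, (∀ i < m₀, π' i = i) ∧ π' ∘ τ = π ∘ τ ∧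
      π' d < m₀ + Nat.card R + 1 := by
  by_cases hd : π d < m₀ + Nat.card R + 1
  · exact ⟨π, h₀, rfl, hd⟩
  · obtain ⟨f, hf₁, hf₂, hf₃⟩ := exists_fresh (π ∘ τ) m₀
    refine ⟨π.trans (Equiv.swap (π d) f), fun i hi => ?_, funext fun r => ?_, ?_⟩
    · rw [Equiv.trans_apply, h₀ i hi]
      exact Equiv.swap_apply_of_ne_of_ne (by omega) (by omega)
    · have := h₁ r
      exact Equiv.swap_apply_of_ne_of_ne (by simp only [ne_eq]; omega) (hf₃ r)
    · rwa [Equiv.trans_apply, Equiv.swap_apply_left]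

theorem map_eq_self_of_fixes {L : Type*} {m₀ : ℕ} {π : ℕ → ℕ} (h₀ : ∀ i < m₀, π i = i)
    {v : List (L × ℕ)} (hv : ∀ p ∈ v, p.2 < m₀) : v.map (Prod.map id π) = v := by
  refine (List.map_congr_left fun p hp => ?_).trans (List.map_id v)
  exact Prod.ext rfl (h₀ _ (hv p hp))

theorem option_map_eq_self_of_fixes {L : Type*} {m₀ : ℕ} {π : ℕ → ℕ} (h₀ : ∀ i < m₀, π i = i)
    {vs : Option (List (L × ℕ))} (hv : ∀ v, vs = some v → ∀ p ∈ v, p.2 < m₀) :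
    vs.map (List.map (Prod.map id π)) = vs := by
  rcases vs with _ | v
  · rfl
  · exact congrArg some (map_eq_self_of_fixes h₀ (hv v rfl))

theorem Shadow.step [Finite R] {T : NRT S G Q R} {X : List (Conf S G Q R)} {m₀ : ℕ}
    (hX : T.Closed X (m₀ + Nat.card R + 1)) {us : List (S × ℕ)} {q : Q} {τ : R → ℕ}
    {vs : Option (List (G × ℕ))} (hs : Shadow X m₀ (m₀ + Nat.card R + 1) us q τ vs)
    {t : Transition S G Q R} (ht : t ∈ T.trans) {d : ℕ} (h : t.Applies (us, q, τ, vs) d) :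
    Shadow X m₀ (m₀ + Nat.card R + 1) us.tail t.dst (t.update τ d)
      (consume (t.word (t.update τ d)) vs) := by
  obtain ⟨π₁, h₁, h₂, h₃, hu, hv⟩ := hs
  obtain ⟨π, h₀, hπ, hd⟩ := exists_perm_lt τ m₀ d π₁ h₁ h₃
  have hinj : Function.Injective (Prod.map id π : G × ℕ → G × ℕ) :=
    Function.injective_id.prodMap π.injective
  have hv' : ∀ v, consume (t.word (t.update τ d)) vs = some v → ∀ p ∈ v, p.2 < m₀ := by
    intro v h p hp
    obtain ⟨v', rfl, rfl⟩ := consume_eq_some h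
    exact hv v' rfl p (List.mem_of_mem_drop hp)
  rw [← hπ] at h₂
  refine ⟨π, h₀, ?_, fun r => ?_, fun p hp => hu p (List.mem_of_mem_tail hp), hv'⟩
  -- Closure is applied to the renamed datum `π d`. The imposed and expected words are unaffected by
  -- the renaming, since their data lie below `m₀`.
  · have := (hX _ h₂).2 (π d) hd t ht ⟨h.1, (Test.sat_comp π.injective).mpr h.2.1, ?_⟩
    · simp only [Transition.next, t.update_comp π, t.word_comp π] at this
      rwa [← option_map_eq_self_of_fixes h₀ hv, consume_map hinj,
        option_map_eq_self_of_fixes h₀ hv'] at this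
    · refine h.2.2.imp_right fun hh => ?_
      have := hu _ (List.mem_of_mem_head? hh)
      rw [h₀ d this]
      exact hh
  · unfold Transition.update
    split_ifs
    · exact hd
    · have := congrFun hπ r
      simp only [Function.comp] at this
      rw [this]
      exact h₃ r

theorem Shadow.fits_tail [Finite R] {T : NRT S G Q R} {X : List (Conf S G Q R)} {m₀ : ℕ}
    (hX : T.Closed X (m₀ + Nat.card R + 1)) {us : List (S × ℕ)} {vs : Option (List (G × ℕ))}
    {ρ : ℕ → Q × (R → ℕ)} {o : ℕ → List (G × ℕ)} {x : ℕ → S × ℕ} {y : ℕ → G × ℕ}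
    (hr : T.IsRun ρ o x y) (hx : IsPre us x)
    (hs : Shadow X m₀ (m₀ + Nat.card R + 1) us (ρ 0).1 (ρ 0).2 vs) :
    Shadow X m₀ (m₀ + Nat.card R + 1) us.tail (ρ 1).1 (ρ 1).2 (consume (o 0) vs) := by
  obtain ⟨t, ht, h₁, h₂, h₃, h₄, h₅⟩ := NRT.step_iff.mp (hr.step 0)
  rw [h₅, h₄]
  refine hs.step hX ht ⟨h₁, h₃, ?_⟩
  rw [h₂]
  exact (isPre_iff_tail.mp hx).1

/-- A mismatch is refuted only after the imposed prefix has been read, since before that a live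
configuration may have no accepting continuation along this prefix. The run is followed to the end
of `us`; its renamed remainder then witnesses that the configuration reached is live. -/
theorem Shadow.not_none [Finite R] {T : NRT S G Q R} {X : List (Conf S G Q R)} {m₀ : ℕ}
    (hX : T.Closed X (m₀ + Nat.card R + 1)) {us : List (S × ℕ)}
    {ρ : ℕ → Q × (R → ℕ)} {o : ℕ → List (G × ℕ)} {x : ℕ → S × ℕ} {y : ℕ → G × ℕ}
    (hr : T.IsRun ρ o x y) (hx : IsPre us x)
    (hs : Shadow X m₀ (m₀ + Nat.card R + 1) us (ρ 0).1 (ρ 0).2 none) : False := by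
  induction us generalizing ρ o x y with
  | nil =>
    obtain ⟨π, -, hmem, -⟩ := hs
    refine (hX _ hmem).1 ⟨rfl, rfl, _, _, NRT.RelFrom.map π.injective ⟨ρ, o, rfl, hr⟩⟩
  | cons l us ih =>
    refine ih hr.tail (isPre_iff_tail.mp hx).2 ?_
    have := hs.fits_tail hX hr hx
    have hn : ∀ w : List (G × ℕ), consume w none = none := by
      intro w
      induction w with
      | nil => rfl
      | cons b w ih => exact ih
    rwa [hn] at this

theorem Shadow.fits [Finite R] {T : NRT S G Q R} {X : List (Conf S G Q R)} {m₀ : ℕ}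
    (hX : T.Closed X (m₀ + Nat.card R + 1)) {us : List (S × ℕ)} {v : List (G × ℕ)}
    {ρ : ℕ → Q × (R → ℕ)} {o : ℕ → List (G × ℕ)} {x : ℕ → S × ℕ} {y : ℕ → G × ℕ}
    (hr : T.IsRun ρ o x y) (hx : IsPre us x)
    (hs : Shadow X m₀ (m₀ + Nat.card R + 1) us (ρ 0).1 (ρ 0).2 (some v)) : IsPre v y := by
  -- The output is infinite, so after some number `N` of steps it is longer than `v`; the induction
  -- is on `N`.
  obtain ⟨N, hN⟩ := (Word.concat_eq_inf_iff.mp hr.out).2 v.length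
  induction N generalizing v us ρ o x y with
  | zero => simp at hN
  | succ N ih =>
    have h₀ := (concat_eq_inf_succ.mp hr.out).1
    have ht := hs.fits_tail hX hr hx
    have hx' := (isPre_iff_tail.mp hx).2
    suffices h : Fits (some v) y by
      obtain ⟨_, h, hv⟩ := h
      cases h
      exact hv
    rw [← fits_consume h₀]
    rcases hc : consume (o 0) (some v) with _ | v'
    · rw [hc] at ht
      exact (ht.not_none hX hr.tail hx').elim
    · rw [hc] at ht
      refine ⟨v', rfl, ?_⟩
      by_cases hv' : v' = []
      · simp [hv']
      refine ih hr.tail hx' ht ?_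
      obtain ⟨_, h, rfl⟩ := consume_eq_some hc
      cases h
      rw [flatMap_range_succ', List.length_append] at hN
      rw [List.drop_eq_nil_iff] at hv'
      rw [List.length_drop]
      omega

/-- Certificates prove what they should. -/
theorem NRT.Certifies.isPre [Finite R] {T : NRT S G Q R} {n₀ : ℕ} {u : List (S × ℕ)}
    {v : List (G × ℕ)} {X : List (Conf S G Q R)} {m : ℕ} (h : T.Certifies n₀ u v X m)
    {x : ℕ → S × ℕ} {y : ℕ → G × ℕ} (hr : T.Rel n₀ x y) (hx : IsPre u x) : IsPre v y := by
  obtain ⟨hu, hv, hn, hmem, hX⟩ := h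
  obtain ⟨ρ, o, h₀, hr⟩ := NRT.rel_iff.mp hr
  refine Shadow.fits hX hr hx ⟨Equiv.refl ℕ, fun _ _ => rfl, ?_, fun r => ?_, hu, ?_⟩
  · simpa [h₀] using hmem
  · simp only [h₀, Equiv.refl_apply]
    omega
  · rintro _ ⟨⟩
    exact hv

/-- All accepting runs that continue `c` fulfil the expectation of `c`. -/
def NRT.Good (T : NRT S G Q R) (c : Conf S G Q R) : Prop :=
  ∀ x y, T.RelFrom (c.2.1, c.2.2.1) x y → IsPre c.1 x → Fits c.2.2.2 y

/-- Any continuation of the successor, preceded by the step, is a continuation of `c`. -/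
theorem NRT.Good.next {T : NRT S G Q R} {c : Conf S G Q R} (hc : T.Good c)
    {t : Transition S G Q R} (ht : t ∈ T.trans) {d : ℕ} (ha : t.Applies c d) :
    T.Good (t.next c d) := by
  intro x y hr hx
  have hs : T.Step (c.2.1, c.2.2.1) (t.label, d) (t.word (t.update c.2.2.1 d))
      (t.dst, t.update c.2.2.1 d) := NRT.step_iff.mpr ⟨t, ht, ha.1, rfl, ha.2.1, rfl, rfl⟩
  have := hc _ _ (NRT.RelFrom.cons hs hr) (isPre_iff_tail.mpr ⟨ha.2.2, by
    simpa [appendInf, Transition.next] using hx⟩)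
  rw [← fits_consume (isPre_appendInf _ y), appendInf_shift] at this
  exact this

theorem finite_box [Finite Q] [Finite R] (u : List (S × ℕ)) (v : List (G × ℕ)) (m : ℕ) :
    {c : Conf S G Q R | c.1 <:+ u ∧ (∀ r, c.2.2.1 r < m) ∧
      ∀ v', c.2.2.2 = some v' → v' <:+ v}.Finite := by
  have h₁ : {l : List (S × ℕ) | l <:+ u}.Finite :=
    (u.tails.finite_toSet).subset fun l hl => (List.mem_tails l u).mpr hl
  have h₂ : {l : List (G × ℕ) | l <:+ v}.Finite :=
    (v.tails.finite_toSet).subset fun l hl => (List.mem_tails l v).mpr hl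
  have h₃ : {τ : R → ℕ | ∀ r, τ r < m}.Finite :=
    (Set.Finite.pi' fun _ : R => Set.finite_Iio m).subset fun τ hτ => hτ
  have h₄ : {vs : Option (List (G × ℕ)) | ∀ v', vs = some v' → v' <:+ v}.Finite := by
    refine ((h₂.image some).insert none).subset fun vs hvs => ?_
    rcases vs with _ | v'
    · exact Set.mem_insert _ _
    · exact Or.inr ⟨v', hvs v' rfl, rfl⟩
  refine (h₁.prod (Set.finite_univ.prod (h₃.prod h₄))).subset ?_
  rintro c ⟨h, h', h''⟩
  exact ⟨h, trivial, h', h''⟩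

/-- Certificates exist. -/
theorem NRT.exists_certifies [Finite Q] [Finite R] (T : NRT S G Q R) (n₀ : ℕ) (u : List (S × ℕ))
    (v : List (G × ℕ)) (h : ∀ x y, T.Rel n₀ x y → IsPre u x → IsPre v y) :
    ∃ X m, T.Certifies n₀ u v X m := by
  obtain ⟨m, hm⟩ : ∃ m, (∀ p ∈ u, p.2 < m) ∧ (∀ p ∈ v, p.2 < m) ∧ n₀ < m := by
    refine ⟨(u.map Prod.snd).sum + (v.map Prod.snd).sum + n₀ + 1, fun p hp => ?_, fun p hp => ?_,
      by omega⟩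
    · have := List.single_le_sum (by simp) _ (List.mem_map_of_mem (f := Prod.snd) hp)
      omega
    · have := List.single_le_sum (by simp) _ (List.mem_map_of_mem (f := Prod.snd) hp)
      omega
  -- The certificate contains every good configuration in the box, reachable or not; closure then
  -- needs only that goodness and the box are preserved.
  have hfin := (finite_box (Q := Q) (R := R) u v (m + Nat.card R + 1)).subset
    (Set.inter_subset_left (t := {c | T.Good c}))
  refine ⟨hfin.toFinset.toList, m, hm.1, hm.2.1, hm.2.2, ?_, ?_⟩
  · rw [Finset.mem_toList, hfin.mem_toFinset]
    refine ⟨⟨List.suffix_rfl, fun r => ?_, ?_⟩, fun x y hr hx => ⟨v, rfl, ?_⟩⟩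
    · simp only
      omega
    · rintro _ ⟨⟩
      exact List.suffix_rfl
    · exact h x y (NRT.rel_iff.mpr hr) hx
  · intro c hc
    rw [Finset.mem_toList, hfin.mem_toFinset] at hc
    obtain ⟨⟨h₁, h₂, h₃⟩, hg⟩ := hc
    constructor
    -- A live configuration with no imposed prefix left has a continuation, which goodness would
    -- force to fit `none`.
    · rintro ⟨hu, hv, x, y, hr⟩
      obtain ⟨w, hw, -⟩ := hg x y hr (by simp [hu])
      rw [hv] at hw
      cases hw
    · intro d hd t ht ha
      rw [Finset.mem_toList, hfin.mem_toFinset]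
      refine ⟨⟨(List.tail_suffix _).trans h₁, fun r => ?_, fun v' hv' => ?_⟩, hg.next ht ha⟩
      · simp only [Transition.next, Transition.update]
        split_ifs
        · exact hd
        · exact h₂ r
      · obtain ⟨w, hw, rfl⟩ := consume_eq_some hv'
        exact (List.drop_suffix _ _).trans (h₃ w hw)

end Certificates

/-! ### Change of the data domain -/

/-- Outside `F` the values are taken in the complement of `k '' F`, which is infinite because `F` is
finite. -/
theorem exists_injective_eqOn {α β : Type*} [Countable α] [Infinite β] {F : Set α}
    (hF : F.Finite) {k : α → β} (hk : F.InjOn k) :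
    ∃ h : α → β, Function.Injective h ∧ F.EqOn h k := by
  classical
  have : Infinite ((k '' F)ᶜ : Set β) := (hF.image k).infinite_compl.to_subtype
  obtain ⟨i, hi⟩ := exists_injective_nat α
  let g := Infinite.natEmbedding ((k '' F)ᶜ : Set β)
  have hg : ∀ n m, n ∈ F → k n ≠ g m := fun n m hn h => (g m).2 (h ▸ Set.mem_image_of_mem k hn)
  refine ⟨fun n => if n ∈ F then k n else g (i n), fun n m hnm => ?_, fun n hn => if_pos hn⟩
  simp only at hnm
  split_ifs at hnm with h₁ h₂ h₂
  · exact hk h₁ h₂ hnm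
  · exact absurd hnm (hg _ _ h₁)
  · exact absurd hnm.symm (hg _ _ h₂)
  · exact hi (g.injective (Subtype.ext hnm))

/-- The numbering `e` need not be surjective, so a run over `ℕ` is brought back to `D` by an
injection `g` that inverts `e` only on the finitely many relevant data: the initial one and those in
`u` and `v`. Such a `g` exists because `D` is infinite. -/
theorem NRT.isPre_of_forall_isPre {S G Q R D : Type*} [Infinite D] {T : NRT S G Q R} {d₀ : D}
    {e : D → ℕ} (he : Function.Injective e) {u : List (S × D)} {v : List (G × D)}
    (h : ∀ x y, T.Rel d₀ x y → IsPre u x → IsPre v y) {x : ℕ → S × ℕ} {y : ℕ → G × ℕ}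
    (hr : T.Rel (e d₀) x y) (hx : IsPre (u.map (Prod.map id e)) x) :
    IsPre (v.map (Prod.map id e)) y := by
  obtain ⟨g, hg, hge⟩ : ∃ g : ℕ → D, Function.Injective g ∧
      ∀ d ∈ insert d₀ ({d | d ∈ u.map Prod.snd} ∪ {d | d ∈ v.map Prod.snd}), g (e d) = d := by
    have hinv := Function.leftInverse_invFun he
    obtain ⟨g, hg, hge⟩ := exists_injective_eqOn (k := Function.invFun e)
      ((((List.finite_toSet (u.map Prod.snd)).union
        (List.finite_toSet (v.map Prod.snd))).insert d₀).image e) (by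
        rintro _ ⟨d, -, rfl⟩ _ ⟨d', -, rfl⟩ h
        rw [hinv, hinv] at h
        rw [h])
    exact ⟨g, hg, fun d hd => (hge (Set.mem_image_of_mem e hd)).trans (hinv d)⟩
  have hr' := hr.map hg
  rw [hge d₀ (Set.mem_insert _ _)] at hr'
  have hu : (u.map (Prod.map id e)).map (Prod.map id g) = u := by
    rw [List.map_map]
    refine (List.map_congr_left fun p hp => ?_).trans (List.map_id u)
    exact Prod.ext rfl (hge _ (Or.inr (Or.inl (List.mem_map_of_mem hp))))
  have hv : (v.map (Prod.map id e)).map (Prod.map id g) = v := by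
    rw [List.map_map]
    refine (List.map_congr_left fun p hp => ?_).trans (List.map_id v)
    exact Prod.ext rfl (hge _ (Or.inr (Or.inr (List.mem_map_of_mem hp))))
  have := h _ _ hr' (by
    rw [← hu]
    exact hx.map _)
  rw [← hv, isPre_map_iff (Function.injective_id.prodMap hg)] at this
  exact this

/-! ### Certificates can be checked by a primitive recursive predicate -/

section PrimrecLemmas

variable {α β ι R : Type*} [Primcodable α] [Primcodable β]

/-- Functions on a finite type are coded as tuples. -/
noncomputable instance primcodableFun [Finite R] : Primcodable (R → β) :=
  Primcodable.ofEquiv (Fin (Finite.exists_equiv_fin R).choose → β)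
    (Equiv.arrowCongr (Finite.exists_equiv_fin R).choose_spec.some (Equiv.refl β))

theorem primrec_fun_iff [Finite R] {f : α → R → β} :
    Primrec f ↔ ∀ r, Primrec fun a => f a r := by
  let e := (Finite.exists_equiv_fin R).choose_spec.some
  have h₁ : Primrec f ↔ Primrec fun a => (Equiv.arrowCongr e (Equiv.refl β)) (f a) :=
    (Primrec.of_equiv_iff _).symm
  have h₂ : Primrec f ↔ ∀ i, Primrec fun a => f a (e.symm i) := by
    rw [h₁, Primrec.fin_curry]
    refine Iff.trans ⟨fun h => h.swap, fun h => h.swap⟩ (Primrec.fin_curry₁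
      (f := fun i a => f a (e.symm i)))
  rw [h₂]
  exact ⟨fun h r => by simpa using h (e r), fun h i => h _⟩

theorem primrecPred_forall_mem {s : Set ι} (hs : s.Finite) {p : ι → α → Prop}
    (h : ∀ i ∈ s, PrimrecPred (p i)) : PrimrecPred fun a => ∀ i ∈ s, p i a := by
  induction s, hs using Set.Finite.induction_on with
  | empty =>
    simpa using PrimrecPred.of_eq (Primrec.eq.comp (Primrec.id (α := α)) Primrec.id) (by simp)
  | insert _ _ ih =>
    simp only [Set.forall_mem_insert]
    exact (h _ (Set.mem_insert _ _)).and (ih fun i hi => h i (Set.mem_insert_of_mem _ hi))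

theorem PrimrecPred.imp {p q : α → Prop} (hp : PrimrecPred p) (hq : PrimrecPred q) :
    PrimrecPred fun a => p a → q a :=
  (hp.not.or hq).of_eq fun a => by rw [imp_iff_not_or]

theorem primrecRel_mem_list : PrimrecRel fun (L : List α) (a : α) => a ∈ L :=
  (PrimrecRel.exists_mem_list Primrec.eq).of_eq fun L a => by simp

theorem primrecRel_forall_snd_lt (α : Type*) [Primcodable α] :
    PrimrecRel fun (l : List (α × ℕ)) (m : ℕ) => ∀ p ∈ l, p.2 < m :=
  PrimrecRel.forall_mem_list (R := fun (p : α × ℕ) (m : ℕ) => p.2 < m)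
    (Primrec.nat_lt.comp (Primrec.snd.comp Primrec.fst) Primrec.snd)

end PrimrecLemmas

theorem Test.primrecPred_sat {R : Type*} [Finite R] (φ : Test R) :
    PrimrecPred fun p : (R → ℕ) × ℕ => φ.Sat p.1 p.2 := by
  have happ : ∀ r, Primrec fun p : (R → ℕ) × ℕ => p.1 r := fun r =>
    primrec_fun_iff.mp Primrec.fst r
  induction φ with
  | top => exact (Primrec.eq.comp Primrec.id Primrec.id).of_eq fun p => by simp [Test.Sat]
  | bot => exact (Primrec.eq.comp Primrec.id Primrec.id).not.of_eq fun p => by simp [Test.Sat]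
  | eq r => exact Primrec.eq.comp (happ r) Primrec.snd
  | ne r => exact (Primrec.eq.comp (happ r) Primrec.snd).not
  | conj φ ψ h₁ h₂ => exact h₁.and h₂
  | disj φ ψ h₁ h₂ => exact h₁.or h₂
  | neg φ h₁ => exact h₁.not

theorem Transition.primrec_update {S G Q R : Type*} [Finite R]
    (t : Transition S G Q R) :
    Primrec fun p : (R → ℕ) × ℕ => t.update p.1 p.2 := by
  refine primrec_fun_iff.mpr fun r => ?_
  by_cases hr : r ∈ t.asgn
  · exact Primrec.snd.of_eq fun p => by simp [Transition.update, hr]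
  · exact (primrec_fun_iff.mp Primrec.fst r).of_eq fun p => by simp [Transition.update, hr]

/-- Two valuations with the same equalities between registers differ by an injective renaming of the
data. -/
theorem NRT.live_of_ker_eq {S G Q R : Type*} [Finite R] (T : NRT S G Q R) {q : Q} {τ τ' : R → ℕ}
    (h : ∀ r r', τ r = τ r' ↔ τ' r = τ' r') (hl : T.Live q τ) : T.Live q τ' := by
  have he : ∀ r, Function.extend τ τ' 0 (τ r) = τ' r := fun r =>
    Function.FactorsThrough.extend_apply (fun r r' hr => (h r r').mp hr) 0 r
  obtain ⟨g, hg, hge⟩ := exists_injective_eqOn (Set.finite_range τ)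
    (k := Function.extend τ τ' 0) (by
      rintro _ ⟨r, rfl⟩ _ ⟨r', rfl⟩ hr
      rw [he, he] at hr
      exact (h r r').mpr hr)
  obtain ⟨x, y, hr⟩ := hl
  have hτ : g ∘ τ = τ' := funext fun r => (hge (Set.mem_range_self r)).trans (he r)
  have := hr.map hg
  simp only [hτ] at this
  exact ⟨_, _, this⟩

/-- By `live_of_ker_eq` the answer depends on a state and a Boolean matrix of equalities. These
range over a finite type, on which every predicate is primitive recursive. -/
theorem NRT.primrecPred_live {S G Q R : Type*} [Primcodable Q] [Finite Q] [Finite R]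
    (T : NRT S G Q R) :
    PrimrecPred fun p : Q × (R → ℕ) => T.Live p.1 p.2 := by
  classical
  let ker : (R → ℕ) → R × R → Bool := fun τ p => decide (τ p.1 = τ p.2)
  have hker : Primrec ker := by
    refine primrec_fun_iff.mpr fun p => ?_
    exact (Primrec.eq.comp (primrec_fun_iff.mp Primrec.id p.1)
      (primrec_fun_iff.mp Primrec.id p.2)).decide
  have htab : PrimrecPred fun p : Q × (R × R → Bool) => ∃ τ, ker τ = p.2 ∧ T.Live p.1 τ :=
    Primrec.primrecPred (Primrec.dom_finite _)
  refine (htab.comp (Primrec.fst.pair (hker.comp Primrec.snd))).of_eq fun p => ?_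
  constructor
  · rintro ⟨τ, hτ, hl⟩
    refine T.live_of_ker_eq (fun r r' => ?_) hl
    simpa [ker] using congrFun hτ (r, r')
  · intro hl
    exact ⟨p.2, rfl, hl⟩

section CheckPrimrec

variable {S G Q R : Type*} [Primcodable S] [Primcodable G] [Primcodable Q] [Finite R]

theorem primrec_consumeOne {α : Type*} [Primcodable α] :
    Primrec fun p : List α × α => consumeOne p.1 p.2 := by
  classical
  refine (Primrec.ite (c := fun p : List α × α => p.1 = [] ∨ p.1.head? = some p.2) ?_
    (Primrec.option_some.comp (Primrec.list_tail.comp Primrec.fst)) (Primrec.const none)).of_eq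
    fun p => ?_
  · exact (Primrec.eq.comp Primrec.fst (Primrec.const [])).or
      (Primrec.eq.comp (Primrec.list_head?.comp Primrec.fst)
        (Primrec.option_some.comp Primrec.snd))
  · unfold consumeOne
    congr

theorem primrec_consume (o : List (G × R)) :
    Primrec fun p : (R → ℕ) × Option (List (G × ℕ)) =>
      consume (o.map fun b => (b.1, p.1 b.2)) p.2 := by
  induction o with
  | nil => exact Primrec.snd
  | cons b o ih =>
    have h₁ : Primrec fun p : (R → ℕ) × Option (List (G × ℕ)) => (b.1, p.1 b.2) :=
      (Primrec.const b.1).pair (primrec_fun_iff.mp Primrec.fst b.2)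
    have h₂ : Primrec fun p : (R → ℕ) × Option (List (G × ℕ)) =>
        p.2.bind fun l => consumeOne l (b.1, p.1 b.2) :=
      Primrec.option_bind Primrec.snd
        (primrec_consumeOne.comp (Primrec.snd.pair (h₁.comp Primrec.fst))).to₂
    exact ih.comp (Primrec.fst.pair h₂)

theorem Transition.primrec_next (t : Transition S G Q R) :
    Primrec fun p : Conf S G Q R × ℕ => t.next p.1 p.2 := by
  have hτ : Primrec fun p : Conf S G Q R × ℕ => t.update p.1.2.2.1 p.2 :=
    t.primrec_update.comp ((Primrec.fst.comp (Primrec.snd.comp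
      (Primrec.snd.comp Primrec.fst))).pair Primrec.snd)
  have hv : Primrec fun p : Conf S G Q R × ℕ => p.1.2.2.2 :=
    Primrec.snd.comp (Primrec.snd.comp (Primrec.snd.comp Primrec.fst))
  exact (Primrec.list_tail.comp (Primrec.fst.comp Primrec.fst)).pair
    ((Primrec.const t.dst).pair (hτ.pair ((primrec_consume t.out).comp (hτ.pair hv))))

theorem Transition.primrecPred_applies (t : Transition S G Q R) :
    PrimrecPred fun p : Conf S G Q R × ℕ => t.Applies p.1 p.2 := by
  have hu : Primrec fun p : Conf S G Q R × ℕ => p.1.1 := Primrec.fst.comp Primrec.fst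
  have hq : Primrec fun p : Conf S G Q R × ℕ => p.1.2.1 :=
    Primrec.fst.comp (Primrec.snd.comp Primrec.fst)
  have hτ : Primrec fun p : Conf S G Q R × ℕ => p.1.2.2.1 :=
    Primrec.fst.comp (Primrec.snd.comp (Primrec.snd.comp Primrec.fst))
  refine (Primrec.eq.comp (Primrec.const t.src) hq).and
    ((t.test.primrecPred_sat.comp (hτ.pair Primrec.snd)).and
      ((Primrec.eq.comp hu (Primrec.const [])).or (Primrec.eq.comp (Primrec.list_head?.comp hu) ?_)))
  exact Primrec.option_some.comp ((Primrec.const t.label).pair Primrec.snd)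

theorem NRT.primrecPred_certifies [Finite Q] (T : NRT S G Q R) (n₀ : ℕ) :
    PrimrecPred fun p : List (S × ℕ) × List (G × ℕ) × List (Conf S G Q R) × ℕ =>
      T.Certifies n₀ p.1 p.2.1 p.2.2.1 p.2.2.2 := by
  have hu : Primrec fun p : List (S × ℕ) × List (G × ℕ) × List (Conf S G Q R) × ℕ => p.1 :=
    Primrec.fst
  have hv : Primrec fun p : List (S × ℕ) × List (G × ℕ) × List (Conf S G Q R) × ℕ => p.2.1 :=
    Primrec.fst.comp Primrec.snd
  have hX : Primrec fun p : List (S × ℕ) × List (G × ℕ) × List (Conf S G Q R) × ℕ => p.2.2.1 :=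
    Primrec.fst.comp (Primrec.snd.comp Primrec.snd)
  have hm : Primrec fun p : List (S × ℕ) × List (G × ℕ) × List (Conf S G Q R) × ℕ => p.2.2.2 :=
    Primrec.snd.comp (Primrec.snd.comp Primrec.snd)
  have hclosed : PrimrecRel fun (c : Conf S G Q R) (p : List (Conf S G Q R) × ℕ) =>
      ¬ (c.1 = [] ∧ c.2.2.2 = none ∧ T.Live c.2.1 c.2.2.1) ∧
        ∀ d < p.2, ∀ t ∈ T.trans, t.Applies c d → t.next c d ∈ p.1 := by
    have hc : Primrec fun p : Conf S G Q R × List (Conf S G Q R) × ℕ => p.1 := Primrec.fst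
    refine PrimrecPred.and (PrimrecPred.not (PrimrecPred.and ?_ (PrimrecPred.and ?_ ?_))) ?_
    · exact Primrec.eq.comp (Primrec.fst.comp hc) (Primrec.const [])
    · exact Primrec.eq.comp (Primrec.snd.comp (Primrec.snd.comp (Primrec.snd.comp hc)))
        (Primrec.const none)
    · exact T.primrecPred_live.comp ((Primrec.fst.comp (Primrec.snd.comp hc)).pair
        (Primrec.fst.comp (Primrec.snd.comp (Primrec.snd.comp hc))))
    · have hd : PrimrecRel fun (d : ℕ) (p : Conf S G Q R × List (Conf S G Q R)) =>
          ∀ t ∈ T.trans, t.Applies p.1 d → t.next p.1 d ∈ p.2 := by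
        refine primrecPred_forall_mem T.finite_trans fun t _ => PrimrecPred.imp ?_ ?_
        · exact t.primrecPred_applies.comp ((Primrec.fst.comp Primrec.snd).pair Primrec.fst)
        · exact primrecRel_mem_list.comp (Primrec.snd.comp Primrec.snd)
            (t.primrec_next.comp ((Primrec.fst.comp Primrec.snd).pair Primrec.fst))
      refine ((PrimrecRel.forall_mem_list hd).comp
        (Primrec.list_range.comp (Primrec.snd.comp Primrec.snd))
        (hc.pair (Primrec.fst.comp Primrec.snd))).of_eq fun p => ?_
      simp only [List.mem_range]
  refine PrimrecPred.and ?_ (PrimrecPred.and ?_ (PrimrecPred.and ?_ (PrimrecPred.and ?_ ?_)))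
  · exact (primrecRel_forall_snd_lt S).comp hu hm
  · exact (primrecRel_forall_snd_lt G).comp hv hm
  · exact Primrec.nat_lt.comp (Primrec.const n₀) hm
  · exact primrecRel_mem_list.comp hX (hu.pair ((Primrec.const T.init).pair
      ((Primrec.const fun _ => n₀).pair (Primrec.option_some.comp hv))))
  · exact (PrimrecRel.forall_mem_list hclosed).comp hX (hX.pair
      (Primrec.succ.comp (Primrec.nat_add.comp hm (Primrec.const (Nat.card R)))))

end CheckPrimrec

open Encodable

/-! ### Coding data words on tapes -/

section Coding

variable {S G D A : Type*}

/-- Tape symbols are labels, digits or the end marker. -/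
def cellEquiv (S A : Type*) : Cell S A ≃ S ⊕ (A ⊕ Unit) where
  toFun
    | .label s => .inl s
    | .digit a => .inr (.inl a)
    | .endMark => .inr (.inr ())
  invFun
    | .inl s => .label s
    | .inr (.inl a) => .digit a
    | .inr (.inr ()) => .endMark
  left_inv c := by cases c <;> rfl
  right_inv c := by rcases c with s | a | _ <;> rfl

instance [Finite S] [Finite A] : Finite (Cell S A) := Finite.of_equiv _ (cellEquiv S A).symm

instance [Primcodable S] [Primcodable A] : Primcodable (Cell S A) :=
  Primcodable.ofEquiv _ (cellEquiv S A)

theorem wordCode_exists_inf (enc : D → List A) (x : ℕ → S × D) :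
    ∃ X, wordCode enc x = Word.inf X := by
  have hlen : ∀ n, n ≤ ((List.range n).flatMap fun n => letterCode enc (x n)).length := by
    intro n
    induction n with
    | zero => exact le_rfl
    | succ n ih =>
      rw [flatMap_range_succ, List.length_append, letterCode, List.length_cons]
      omega
  refine ⟨fun i => ((List.range (i + 1)).flatMap fun n => letterCode enc (x n))[i]'(hlen (i + 1)),
    Stream'.Seq.ext fun i => ?_⟩
  rw [Word.inf_get?]
  exact Word.concat_get?_eq_some_iff.mpr ⟨i + 1, List.getElem?_eq_getElem _⟩

/-- The code of a finite data word. -/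
def listCode (enc : D → List A) (l : List (S × D)) : List (Cell S A) :=
  l.flatMap (letterCode enc)

theorem length_le_listCode (enc : D → List A) (l : List (S × D)) :
    l.length ≤ (listCode enc l).length := by
  induction l with
  | nil => exact le_rfl
  | cons a l ih =>
    simp only [listCode, List.flatMap_cons, List.length_append, letterCode, List.length_cons] at ih ⊢
    omega

theorem isPre_listCode {enc : D → List A} {x : ℕ → S × D} {X : ℕ → Cell S A}
    (hX : wordCode enc x = Word.inf X) {l : List (S × D)} (hl : IsPre l x) :
    IsPre (listCode enc l) X := by
  have := (Word.concat_eq_inf_iff.mp hX).1 l.length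
  rw [isPre_iff_eq_takePre.mp hl, listCode, takePre, List.flatMap_map]
  exact this

/-- The data words that have been read: complete letters, and the label and the digits of an
incomplete letter. -/
abbrev Parsed (S A : Type*) := List (S × ℕ) × Option (S × List A)

variable [Primcodable A]

/-- Reading one more cell. Data are represented by the codes of the words that represent them. -/
def parseStep (st : Parsed S A) : Cell S A → Parsed S A
  | .label s => (st.1, some (s, []))
  | .digit a => (st.1, st.2.map fun p => (p.1, p.2 ++ [a]))
  | .endMark => (st.1 ++ (st.2.map fun p => (p.1, encode p.2)).toList, none)

/-- The complete letters in a finite tape content. -/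
def parse (l : List (Cell S A)) : List (S × ℕ) := (l.foldl parseStep ([], none)).1

theorem foldl_parseStep_letterCode (enc : D → List A) (st : Parsed S A) (l : S × D) :
    (letterCode enc l).foldl parseStep st = (st.1 ++ [(l.1, encode (enc l.2))], none) := by
  have key : ∀ (w w' : List A), (w.map Cell.digit).foldl parseStep (st.1, some (l.1, w')) =
      (st.1, some (l.1, w' ++ w)) := by
    intro w
    induction w with
    | nil => simp
    | cons a w ih =>
      intro w'
      simp [parseStep, ih]
  simp [letterCode, parseStep, key]

theorem parse_listCode (enc : D → List A) (l : List (S × D)) :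
    parse (listCode enc l) = l.map (Prod.map id fun d => encode (enc d)) := by
  have key : ∀ st : Parsed S A, ((listCode enc l).foldl parseStep st).1 =
      st.1 ++ l.map (Prod.map id fun d => encode (enc d)) := by
    induction l with
    | nil => simp [listCode]
    | cons a l ih =>
      intro st
      rw [listCode, List.flatMap_cons, List.foldl_append, foldl_parseStep_letterCode,
        ← listCode, ih]
      simp [Prod.map]
  exact key _

theorem parse_prefix {l l' : List (Cell S A)} (h : l <+: l') : parse l <+: parse l' := by
  obtain ⟨t, rfl⟩ := h
  rw [parse, parse, List.foldl_append]
  generalize l.foldl parseStep ([], none) = st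
  induction t generalizing st with
  | nil => exact List.prefix_rfl
  | cons c t ih =>
    refine List.IsPrefix.trans ?_ (ih (parseStep st c))
    cases c with
    | label s => exact List.prefix_rfl
    | digit a => exact List.prefix_rfl
    | endMark => exact List.prefix_append _ _

theorem isPre_parse {enc : D → List A} {x : ℕ → S × D} {X : ℕ → Cell S A}
    (hX : wordCode enc x = Word.inf X) (k : ℕ) :
    IsPre (parse (takePre k X)) (Prod.map id (fun d => encode (enc d)) ∘ x) := by
  have h₁ := isPre_listCode hX (isPre_takePre k x)
  -- Each letter occupies at least one cell, so the codes of `k` letters cover the first `k` cells.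
  have h₂ := (isPre_takePre k X).prefix_of_length_le h₁ (by
    simpa using length_le_listCode enc (takePre k x))
  refine IsPre.of_prefix ?_ (parse_prefix h₂)
  rw [parse_listCode]
  exact (isPre_takePre k x).map _

theorem parse_take {enc : D → List A} {x : ℕ → S × D} {X : ℕ → Cell S A}
    (hX : wordCode enc x = Word.inf X) {n k : ℕ}
    (hk : (listCode enc (takePre n x)).length ≤ k) :
    (parse (takePre k X)).take n = (takePre n x).map (Prod.map id fun d => encode (enc d)) := by
  have h₁ := (isPre_listCode hX (isPre_takePre n x)).prefix_of_length_le (isPre_takePre k X)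
    (by simpa using hk)
  obtain ⟨t, ht⟩ := parse_prefix h₁
  rw [← ht, parse_listCode, List.take_left' (by simp)]

theorem primrec_parse [Primcodable S] : Primrec (parse : List (Cell S A) → List (S × ℕ)) := by
  have hstep : Primrec fun p : Parsed S A × Cell S A => parseStep p.1 p.2 := by
    have hd : Primrec fun p : Parsed S A × Cell S A => p.1.1 := Primrec.fst.comp Primrec.fst
    have hc : Primrec fun p : Parsed S A × Cell S A => p.1.2 := Primrec.snd.comp Primrec.fst
    have h₁ : Primrec₂ fun (p : Parsed S A × Cell S A) (s : S) =>
        ((p.1.1, some (s, [])) : Parsed S A) :=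
      (hd.comp Primrec.fst).pair
        (Primrec.option_some.comp (Primrec.snd.pair (Primrec.const [])))
    have h₂ : Primrec₂ fun (p : Parsed S A × Cell S A) (a : A) =>
        ((p.1.1, p.1.2.map fun q => (q.1, q.2 ++ [a])) : Parsed S A) := by
      refine (hd.comp Primrec.fst).pair (Primrec.option_map (hc.comp Primrec.fst) ?_)
      exact (Primrec.fst.comp Primrec.snd).pair (Primrec.list_concat.comp
        (Primrec.snd.comp Primrec.snd) (Primrec.snd.comp Primrec.fst))
    have h₃ : Primrec₂ fun (p : Parsed S A × Cell S A) (_ : Unit) =>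
        ((p.1.1 ++ (p.1.2.map fun q => (q.1, encode q.2)).toList, none) : Parsed S A) := by
      refine Primrec.pair (Primrec.list_append.comp (hd.comp Primrec.fst)
        (Primrec.optionToList.comp (Primrec.option_map (hc.comp Primrec.fst) ?_)))
        (Primrec.const none)
      exact (Primrec.fst.comp Primrec.snd).pair
        (Primrec.encode.comp (Primrec.snd.comp Primrec.snd))
    have hcell : Primrec fun p : Parsed S A × Cell S A => cellEquiv S A p.2 :=
      (Primrec.of_equiv (e := cellEquiv S A)).comp Primrec.snd
    have h₄ : Primrec₂ fun (p : Parsed S A × Cell S A) (c : A ⊕ Unit) =>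
        (Sum.casesOn c (fun a => (p.1.1, p.1.2.map fun q => (q.1, q.2 ++ [a])))
          (fun _ => (p.1.1 ++ (p.1.2.map fun q => (q.1, encode q.2)).toList, none)) :
          Parsed S A) :=
      Primrec.sumCasesOn Primrec.snd (h₂.comp (Primrec.fst.comp Primrec.fst) Primrec.snd).to₂
        (h₃.comp (Primrec.fst.comp Primrec.fst) Primrec.snd).to₂
    refine (Primrec.sumCasesOn hcell h₁ h₄).of_eq ?_
    rintro ⟨p, s | a | _⟩ <;> rfl
  exact Primrec.fst.comp (Primrec.list_foldl Primrec.id (Primrec.const ([], none))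
    (hstep.comp Primrec.snd).to₂)

/-- The word with a given code. -/
def wordOf (A : Type*) [Primcodable A] (n : ℕ) : List A := (decode (α := List A) n).getD []

/-- A datum is named by the code of its representing word, so that word is recovered by decoding,
and `enc` itself never has to be computed. -/
theorem listCode_wordOf (enc : D → List A) (l : List (S × D)) :
    listCode (wordOf A) (l.map (Prod.map id fun d => encode (enc d))) = listCode enc l := by
  simp only [listCode, List.flatMap_map]
  congr 1
  funext a
  simp [letterCode, wordOf]

theorem primrec_listCode_wordOf [Primcodable G] :
    Primrec (listCode (wordOf A) : List (G × ℕ) → List (Cell G A)) := by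
  have hlabel : Primrec (Cell.label : G → Cell G A) :=
    (Primrec.of_equiv_symm (e := cellEquiv G A)).comp Primrec.sumInl
  have hdigit : Primrec (Cell.digit : A → Cell G A) :=
    (Primrec.of_equiv_symm (e := cellEquiv G A)).comp (Primrec.sumInr.comp Primrec.sumInl)
  have hword : Primrec (wordOf A) :=
    Primrec.option_getD.comp Primrec.decode (Primrec.const [])
  refine Primrec.list_flatMap Primrec.id (Primrec.list_cons.comp
    (hlabel.comp (Primrec.fst.comp Primrec.snd)) (Primrec.list_append.comp (Primrec.list_map
      (hword.comp (Primrec.snd.comp Primrec.snd)) (hdigit.comp Primrec.snd).to₂)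
      (Primrec.const [Cell.endMark])))

end Coding

/-! ### Computable functions are continuous -/

theorem IsComputable.isContinuous {S G D A : Type*} [Finite A] {enc : D → List A}
    (henc : Function.Injective enc) {f : (ℕ → S × D) →. (ℕ → G × D)} (hf : IsComputable enc f) :
    IsContinuous f := by
  obtain ⟨n, ⟨e⟩⟩ := Finite.exists_equiv_fin A
  let : Primcodable A := Primcodable.ofEquiv _ e
  obtain ⟨Q, W, _, _, _, M, hM⟩ := hf
  refine (isContinuous_iff f).mpr fun x hx k => ?_
  obtain ⟨X, hX⟩ := wordCode_exists_inf enc x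
  obtain ⟨Y, hY⟩ := wordCode_exists_inf enc (f.fn x hx)
  have hMx := hM x hx
  rw [hY, hX] at hMx
  obtain ⟨N, hN⟩ := Word.convergesTo_iff.mp hMx (listCode enc (takePre k (f.fn x hx))).length
  refine ⟨N, fun y hy hxy => ?_⟩
  obtain ⟨X', hX'⟩ := wordCode_exists_inf enc y
  obtain ⟨Y', hY'⟩ := wordCode_exists_inf enc (f.fn y hy)
  have hMy := hM y hy
  rw [hY', hX'] at hMy
  have hXX : M.output (Word.inf X) N = M.output (Word.inf X') N := by
    refine M.output_congr fun i hi => ?_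
    have hi' : i < (listCode enc (takePre N x)).length :=
      hi.trans_le (by simpa using length_le_listCode enc (takePre N x))
    have h₁ := isPre_listCode hX (isPre_takePre N x) i _ (List.getElem?_eq_getElem hi')
    have h₂ := isPre_listCode hX' hxy i _ (List.getElem?_eq_getElem hi')
    rw [Word.inf_get?, Word.inf_get?, h₁, h₂]
  have hYY : IsPre (listCode enc (takePre k (f.fn x hx))) Y' := by
    intro i a hi
    have h₁ := isPre_listCode hY (isPre_takePre k _) i a hi
    have h₂ := hN N le_rfl i (List.getElem?_eq_some_iff.mp hi).1
    simp only [hXX, Word.inf_get?, h₁] at h₂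
    have := M.get?_of_output_convergesTo _ hMy h₂
    rw [Word.inf_get?] at this
    exact Option.some.inj this
  -- The code of the prefix of `f x` begins `Y'`; cutting it into letters recovers the prefix, up to
  -- the injective numbering of the data.
  have hp := isPre_parse hY' (listCode enc (takePre k (f.fn x hx))).length
  rw [← isPre_iff_eq_takePre.mp hYY, parse_listCode] at hp
  exact (isPre_map_iff (Function.injective_id.prodMap (encode_injective.comp henc))).mp hp

/-! ### Continuous functions defined by transducers are computable -/

theorem IsContinuous.isComputable {S G D A Q R : Type*} [Finite S] [Finite G] [Infinite D]
    [Finite A] [Finite Q] [Finite R] {enc : D → List A} (henc : Function.Injective enc) {d₀ : D}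
    {T : NRT S G Q R} {f : (ℕ → S × D) →. (ℕ → G × D)} (hf : ∀ u v, v ∈ f u ↔ T.Rel d₀ u v)
    (hc : IsContinuous f) : IsComputable enc f := by
  classical
  obtain ⟨_, ⟨eA⟩⟩ := Finite.exists_equiv_fin A
  obtain ⟨_, ⟨eS⟩⟩ := Finite.exists_equiv_fin S
  obtain ⟨_, ⟨eG⟩⟩ := Finite.exists_equiv_fin G
  obtain ⟨_, ⟨eQ⟩⟩ := Finite.exists_equiv_fin Q
  let : Primcodable A := Primcodable.ofEquiv _ eA
  let : Primcodable S := Primcodable.ofEquiv _ eS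
  let : Primcodable G := Primcodable.ofEquiv _ eG
  let : Primcodable Q := Primcodable.ofEquiv _ eQ
  let e : D → ℕ := fun d => encode (enc d)
  have he : Function.Injective e := encode_injective.comp henc
  let Cert := ℕ × List (G × ℕ) × List (Conf S G Q R) × ℕ
  -- The search is driven by the length of the tape prefix: its first unpaired component is the
  -- candidate certificate, tested against the first `n` letters read, where `n` is part of the
  -- candidate. Successive values need not grow, as only correctness and unbounded length are
  -- required.
  let g : List (Cell S A) → List (Cell G A) := fun l =>
    (decode (α := Cert) l.length.unpair.1).elim [] fun c =>
      if T.Certifies (e d₀) ((parse l).take c.1) c.2.1 c.2.2.1 c.2.2.2 then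
        listCode (wordOf A) c.2.1 else []
  have hg : Primrec g := by
    have hdec : Primrec fun l : List (Cell S A) => decode (α := Cert) l.length.unpair.1 :=
      Primrec.decode.comp (Primrec.fst.comp (Primrec.unpair.comp Primrec.list_length))
    have hite : Primrec₂ fun (l : List (Cell S A)) (c : Cert) =>
        if T.Certifies (e d₀) ((parse l).take c.1) c.2.1 c.2.2.1 c.2.2.2 then
          listCode (wordOf A) c.2.1 else [] := by
      refine Primrec.ite ((T.primrecPred_certifies (e d₀)).comp (Primrec.pair
        (Primrec.list_take.comp (Primrec.fst.comp Primrec.snd) (primrec_parse.comp Primrec.fst))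
        (Primrec.snd.comp Primrec.snd))) ?_ (Primrec.const [])
      exact primrec_listCode_wordOf.comp (Primrec.fst.comp (Primrec.snd.comp Primrec.snd))
    refine (Primrec.option_casesOn hdec (Primrec.const []) hite).of_eq fun l => ?_
    simp only [g]
    cases decode (α := Cert) l.length.unpair.1 <;> rfl
  obtain ⟨Q', W, i₁, i₂, i₃, M, hM⟩ := exists_machine hg.to_comp
  refine ⟨Q', W, i₁, i₂, i₃, M, fun x hx => ?_⟩
  obtain ⟨X, hX⟩ := wordCode_exists_inf enc x
  obtain ⟨Y, hY⟩ := wordCode_exists_inf enc (f.fn x hx)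
  have hxy : T.Rel d₀ x (f.fn x hx) := (hf _ _).mp (Part.get_mem hx)
  rw [hX, hY]
  refine hM X Y (fun k => ?_) (fun k => ?_)
  · simp only [g]
    rcases decode (α := Cert) (takePre k X).length.unpair.1 with _ | ⟨n, v, C, m⟩
    · exact isPre_nil Y
    · simp only [Option.elim_some]
      split_ifs with hcert
      · have hv := hcert.isPre (hxy.map he) ((isPre_parse hX k).of_prefix (List.take_prefix _ _))
        rw [isPre_iff_eq_takePre.mp hv, ← takePre_map, listCode_wordOf]
        exact isPre_listCode hY (isPre_takePre _ _)
      · exact isPre_nil Y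
  · obtain ⟨n, hn⟩ := (isContinuous_iff f).mp hc x hx k
    obtain ⟨C, m, hC⟩ := T.exists_certifies (e d₀) ((takePre n x).map (Prod.map id e))
      ((takePre k (f.fn x hx)).map (Prod.map id e)) fun x' y' hr hx' => by
        refine NRT.isPre_of_forall_isPre he (fun y z hyz hxy' => ?_) hr hx'
        have hz := (hf y z).mpr hyz
        have := hn y (Part.dom_iff_mem.mpr ⟨z, hz⟩) hxy'
        rwa [show f.fn y _ = z from Part.get_eq_of_mem hz _] at this
    let c : Cert := (n, (takePre k (f.fn x hx)).map (Prod.map id e), C, m)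
    -- The second component pads the prefix: a pair is at least as large as its second component, so
    -- the `n` letters needed have been read when `c` is tried.
    refine ⟨Nat.pair (encode c) (listCode enc (takePre n x)).length, ?_⟩
    simp only [g, takePre_length, Nat.unpair_pair, encodek, Option.elim_some, c]
    rw [parse_take hX (Nat.right_le_pair _ _), if_pos hC, listCode_wordOf]
    simpa using length_le_listCode enc (takePre k (f.fn x hx))

end DataWord

theorem mainTheorem2 {S G D A Q R : Type*} [Finite S] [Finite G] [Infinite D] [Finite A]
    [Finite Q] [Finite R] (enc : D → List A) (henc : Function.Injective enc) (d₀ : D)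
    (T : DataWord.NRT S G Q R) (f : (ℕ → S × D) →. (ℕ → G × D))
    (hf : ∀ u v, v ∈ f u ↔ T.Rel d₀ u v) :
    DataWord.IsContinuous f ↔ DataWord.IsComputable enc f :=
  ⟨fun h => h.isComputable henc hf, fun h => h.isContinuous henc⟩
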